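/- Let $\Lambda$ be a finite set, $\rho\notin\Lambda$, and let $E$ be the edge set of the complete graph (without loops) on $\Lambda\cup\{\rho\}$. Let $W_e=W_{ij}=W_{ji}\ge 0$, $e=\{i,j\}\in E$, be weights (the weights $W_{i\rho}=h_i$ are the pinning strengths), put $E_+=\{e\in E: W_e>0\}$, and assume that the graph $G_+=(\Lambda\cup\{\rho\},E_+)$ is connected. For $u,s\in\mathbb R^\Lambda$ put $u_\rho=s_\rho=0$ and, for $e=\{i,j\}\in E$, $$B_e=B_e(u,s)=\cosh(u_i-u_j)+\tfrac12(s_i-s_j)^2e^{u_i+u_j}.$$ Let $D=D(u)\in\mathbb R^{\Lambda\times\Lambda}$ be the weighted Laplacian of $G_+$ with $\rho$ removed: $D_{ij}=-W_{ij}e^{u_i+u_j}$ for $i\ne j$ and $D_{ii}=\sum_{k\in\Lambda\cup\{\rho\},\,k\ne i}W_{ik}e^{u_i+u_k}$. Let $\mathbb E$ denote the expectation with respect to the measure of the $H^{2|2}$ model on $\mathbb R^\Lambda\times\mathbb R^\Lambda$, $$\mu(du\,ds)=e^{-\sum_{e\in E_+}W_e(B_e-1)}\,\det D\,\prod_{i\in\Lambda}\frac{e^{-u_i}}{2\pi}\,du_i\,ds_i.$$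 Choose for every edge $e\in E$ an arbitrary labelling $e_+,e_-$ of its two end points, and let $F_{k,e}=1_{\{e_+=k\}}-1_{\{e_-=k\}}$ for $k\in\Lambda$, $e\in E$, be the signed incidence matrix. Put $Q=\operatorname{diag}(Q_e,e\in E)$ with $Q_e=e^{u_{e_+}+u_{e_-}}/B_e$, and $\mathcal G=\sqrt Q\,F^tD^{-1}F\sqrt Q\in\mathbb R^{E\times E}$. Let $m_e\ge 0$, $e\in E$, be real numbers and $M=\operatorname{diag}(m_e,e\in E)$. Then the following hold, all random variables involved being integrable. (a) $$\mathbb E\Big[\prod_{e\in E}B_e^{m_e}\cdot\det(\operatorname{Id}-M\mathcal G)\Big]=1.$$ (b) If in addition $0\le m_e<W_e$ for $e\in E_+$ and $m_e=0$ for $e\in E\setminus E_+$, then $$\mathbb E\Big[\prod_{e\in E_+}\cosh(u_{e_+}-u_{e_-})^{m_e}\Big]\le\mathbb E\Big[\prod_{e\in E_+}B_e^{m_e}\Big]\le\prod_{e\in E_+}\frac1{1-\frac{m_e}{W_e}}.$$ -/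

import Mathlib

open MeasureTheory

noncomputable section

namespace H22

/-- The edge set `E` of the complete graph on `Λ ∪ {ρ}`: unordered pairs of distinct vertices.
The vertex set `Λ ∪ {ρ}` is `Option Λ`; the pinning point `ρ` is `none`. -/
abbrev Edge (Λ : Type*) : Type _ := {e : Sym2 (Option Λ) // ¬ e.IsDiag}

/-- `W_{ij}` for vertices `i, j` of `Λ ∪ {ρ}`, read off from the edge weights; there are no loops,
so `W_{ii}` is put equal to `0`. -/
def weight {Λ : Type*} [DecidableEq Λ] (W : Edge Λ → ℝ) (i j : Option Λ) : ℝ :=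
  if h : i = j then 0 else W ⟨s(i, j), by simpa using h⟩

theorem weight_comm {Λ : Type*} [DecidableEq Λ] (W : Edge Λ → ℝ) (i j : Option Λ) :
    weight W i j = weight W j i := by
  by_cases h : i = j
  · subst h; rfl
  · simp only [weight, h, Ne.symm h, dite_false, Sym2.eq_swap]

/-- The graph `G_+` on `Λ ∪ {ρ}`, whose edges are the edges of positive weight. -/
def graphPlus {Λ : Type*} [DecidableEq Λ] (W : Edge Λ → ℝ) : SimpleGraph (Option Λ) where
  Adj i j := 0 < weight W i j
  symm := ⟨fun i j h => by rwa [weight_comm W j i]⟩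
  loopless := ⟨fun i h => by simp [weight] at h⟩

/-- The set `E_+` of edges of positive weight. -/
def edgesPlus {Λ : Type*} [Fintype Λ] [DecidableEq Λ] (W : Edge Λ → ℝ) : Finset (Edge Λ) :=
  Finset.univ.filter fun e => 0 < W e

/-- A choice of the two end points `e_+` and `e_-` of every edge. -/
structure Orientation (Λ : Type*) where
  plus : Edge Λ → Option Λ
  minus : Edge Λ → Option Λ
  mk_eq : ∀ e, s(plus e, minus e) = (e : Sym2 (Option Λ))

/-- Extension of a field on `Λ` to `Λ ∪ {ρ}` by the value `0` at `ρ`. -/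
def ext {Λ : Type*} (u : Λ → ℝ) (i : Option Λ) : ℝ := i.elim 0 u

/-- `B_{ij} = cosh (u_i - u_j) + (s_i - s_j)² e^{u_i + u_j} / 2`. -/
def B {Λ : Type*} (u s : Λ → ℝ) (i j : Option Λ) : ℝ :=
  Real.cosh (ext u i - ext u j) +
    1 / 2 * (ext s i - ext s j) ^ 2 * Real.exp (ext u i + ext u j)

theorem B_comm {Λ : Type*} (u s : Λ → ℝ) (i j : Option Λ) : B u s i j = B u s j i := by
  unfold B
  rw [← Real.cosh_neg, add_comm (ext u i) (ext u j)]
  ring_nf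

/-- `B_e = B_{ij}` for an edge `e = {i, j}`. -/
def edgeB {Λ : Type*} (u s : Λ → ℝ) (e : Edge Λ) : ℝ :=
  Sym2.lift ⟨B u s, B_comm u s⟩ e.1

/-- The weighted Laplacian `D(u)` of `G_+` with the row and column of `ρ` removed. (Edges outside
`E_+` have weight `0`, hence do not contribute.) -/
def D {Λ : Type*} [Fintype Λ] [DecidableEq Λ] (W : Edge Λ → ℝ) (u : Λ → ℝ) : Matrix Λ Λ ℝ :=
  Matrix.of fun i j =>
    if i = j then ∑ k : Option Λ, weight W (some i) k * Real.exp (ext u (some i) + ext u k)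
    else - (weight W (some i) (some j) * Real.exp (ext u (some i) + ext u (some j)))

/-- The density of `μ_{W,h}` with respect to Lebesgue measure `du ds`. -/
def density {Λ : Type*} [Fintype Λ] [DecidableEq Λ] (W : Edge Λ → ℝ) (u s : Λ → ℝ) : ℝ :=
  Real.exp (- ∑ e ∈ edgesPlus W, W e * (edgeB u s e - 1)) * (D W u).det *
    ∏ i : Λ, (Real.exp (- u i) / (2 * Real.pi))

/-- The measure `μ_{W,h}` of the `H^{2|2}` model on pairs `(u, s)` of real fields on `Λ`. -/
def mu {Λ : Type*} [Fintype Λ] [DecidableEq Λ] (W : Edge Λ → ℝ) :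
    Measure ((Λ → ℝ) × (Λ → ℝ)) :=
  volume.withDensity fun p => ENNReal.ofReal (density W p.1 p.2)

/-- The signed incidence matrix `F`, with the row of `ρ` removed. -/
def F {Λ : Type*} [DecidableEq Λ] (o : Orientation Λ) : Matrix Λ (Edge Λ) ℝ :=
  Matrix.of fun k e =>
    (if o.plus e = some k then 1 else 0) - (if o.minus e = some k then 1 else 0)

/-- `Q_e = e^{u_{e_+} + u_{e_-}} / B_e`. -/
def Q {Λ : Type*} (o : Orientation Λ) (u s : Λ → ℝ) (e : Edge Λ) : ℝ :=
  Real.exp (ext u (o.plus e) + ext u (o.minus e)) / edgeB u s e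

/-- `𝒢 = √Q Fᵗ D⁻¹ F √Q`, a matrix indexed by the edges. -/
def calG {Λ : Type*} [Fintype Λ] [DecidableEq Λ] (W : Edge Λ → ℝ) (o : Orientation Λ)
    (u s : Λ → ℝ) : Matrix (Edge Λ) (Edge Λ) ℝ :=
  Matrix.diagonal (fun e => √(Q o u s e)) * (F o).transpose * (D W u)⁻¹ * F o *
    Matrix.diagonal (fun e => √(Q o u s e))

end H22

end

/-!
The identity is an instance of supersymmetric localization. For functions `f_e` of one variable,
consider the integral over `(u, s)` of `∏ f_e (B_e)` times the determinant of the Laplacian with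
edge weights `- f_e' (B_e) / f_e (B_e) · e^{u_i + u_j}` and times `∏ e^{- u_i} / 2π`. The determinant
of a Laplacian is affine in the weight of each edge (`det_lap_update`), so this integral is affine in
every pair `(f_e, f_e')`, and localization says that its value is `∏ f_e (1)`. With
`f_e (B) = B ^ {m_e} e^{- W_e B}` the Weinstein–Aronszajn identity (`det_D_mul_det`) turns the
Laplacian determinant into `det D · det (1 - M 𝒢)`, which gives the first assertion.

For pure exponentials `f_e` with positive weights, localization is the normalization of the
`H^{2|2}` measure (`lintegral_exp_neg_energy`). The field `s` is Gaussian given `u`, and the map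
`u ↦ γ`, `γ_i = ∑_k W_{ik} e^{u_k - u_i}`, is a bijection from the fields onto the potentials `γ` for
which the Schrödinger operator `H = diag γ - W` is positive definite, because `e^u = H⁻¹ h`. In these
coordinates the integral is computed by eliminating one vertex after the other with Schur complements
(`lintegral_schrDensity`): each step is an inverse Gaussian integral, and the couplings to the
eliminated vertex become additional pinning.

The edges are then converted one at a time (`integral_locDensity`) from `e^{- w B}`, `w > W_e`, to
`B ^ m e^{- W B}`: differentiation in `w` produces integer powers, and a Gamma mixture over `w`
produces real ones (`integral_rpow_mul_exp_of_exp`). The interchanges are justified by the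
multiplicative triangle inequality `B_{ij} ≤ 2 B_{ik} B_{kj}`: along paths in the connected graph
`G_+` it bounds every pinning term `B_{iρ}` by a power of the energy, so that `exp (- energy)`
integrates every function of polynomial growth (`PolyGrowth.integrable`).

For the second assertion, `W_e - m_e / B_e ≥ (1 - m_e / W_e) W_e`, and lowering weights of a Laplacian
by factors in `[0, 1]` lowers the determinant at most by their product (`prod_mul_det_lap_le`). Hence
`det (1 - M 𝒢) ≥ ∏ (1 - m_e / W_e)` pointwise, and the bound follows from the identity.
-/

noncomputable section

namespace H22

/-! ### Edge sums and weighted Laplacians -/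

section
variable {Λ : Type*}

theorem Orientation.plus_ne_minus (o : Orientation Λ) (e : Edge Λ) : o.plus e ≠ o.minus e := by
  intro h
  have h1 := e.2
  rw [← o.mk_eq e, h] at h1
  exact h1 (Sym2.mk_isDiag_iff.2 rfl)

theorem edgeB_eq (o : Orientation Λ) (u s : Λ → ℝ) (e : Edge Λ) :
    edgeB u s e = B u s (o.plus e) (o.minus e) := by
  unfold edgeB
  rw [← o.mk_eq e, Sym2.lift_mk]

theorem weight_eq [DecidableEq Λ] (o : Orientation Λ) (W : Edge Λ → ℝ) (e : Edge Λ) :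
    weight W (o.plus e) (o.minus e) = W e := by
  have h := o.plus_ne_minus e
  rw [weight, dif_neg h]
  congr 1
  exact Subtype.ext (o.mk_eq e)

theorem weight_self [DecidableEq Λ] (W : Edge Λ → ℝ) (i : Option Λ) : weight W i i = 0 := by
  simp [weight]

theorem weight_nonneg [DecidableEq Λ] {W : Edge Λ → ℝ} (hW : ∀ e, 0 ≤ W e) (i j : Option Λ) :
    0 ≤ weight W i j := by
  unfold weight
  split_ifs
  · exact le_rfl
  · exact hW _

theorem weight_pos [DecidableEq Λ] {W : Edge Λ → ℝ} (hW : ∀ e, 0 < W e) {i j : Option Λ}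
    (h : i ≠ j) : 0 < weight W i j := by
  rw [weight, dif_neg h]
  exact hW _

/-- A double sum over ordered pairs of vertices which vanishes on the diagonal is a sum over the
edges, each edge being counted in its two directions. -/
theorem sum_pairs_eq_sum_edges [Fintype Λ] [DecidableEq Λ] (o : Orientation Λ)
    (φ : Option Λ → Option Λ → ℝ) (hφ : ∀ i, φ i i = 0) :
    ∑ i, ∑ j, φ i j = ∑ e, (φ (o.plus e) (o.minus e) + φ (o.minus e) (o.plus e)) := by
  rw [Finset.sum_add_distrib, ← Finset.sum_product']
  have h1 : ∑ x ∈ (Finset.univ : Finset (Option Λ)) ×ˢ (Finset.univ : Finset (Option Λ)),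
      φ x.1 x.2 = ∑ x : Edge Λ ⊕ Edge Λ, Sum.elim (fun e => φ (o.plus e) (o.minus e))
        (fun e => φ (o.minus e) (o.plus e)) x := by
    -- Off the diagonal, each ordered pair is one of the two directions of exactly one edge.
    symm
    refine Finset.sum_of_injOn
      (Sum.elim (fun e => (o.plus e, o.minus e)) (fun e => (o.minus e, o.plus e))) ?_ ?_ ?_ ?_
    · have key : ∀ e e' : Edge Λ, s(o.plus e, o.minus e) = s(o.plus e', o.minus e') → e = e' := by
        intro e e' h
        rw [o.mk_eq, o.mk_eq] at h
        exact Subtype.ext h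
      rintro (e | e) - (e' | e') - h <;> simp only [Sum.elim_inl, Sum.elim_inr, Prod.mk.injEq] at h
      · rw [key e e' (by rw [h.1, h.2])]
      · exfalso
        have := key e e' (by rw [h.1, h.2, Sym2.eq_swap])
        subst this
        exact o.plus_ne_minus e h.1
      · exfalso
        have := key e e' (by rw [h.1, h.2, Sym2.eq_swap])
        subst this
        exact o.plus_ne_minus e h.2
      · rw [key e e' (by rw [h.1, h.2])]
    · intro x _
      simp
    · rintro ⟨i, j⟩ - hx
      by_cases hij : i = j
      · subst hij; exact hφ i
      exfalso
      apply hx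
      have he := o.mk_eq ⟨s(i, j), by simpa using hij⟩
      simp only [Sym2.eq_iff] at he
      rcases he with he | he
      · exact ⟨Sum.inl ⟨s(i, j), by simpa using hij⟩, by simp, by simp [he.1, he.2]⟩
      · exact ⟨Sum.inr ⟨s(i, j), by simpa using hij⟩, by simp, by simp [he.1, he.2]⟩
    · rintro (e | e) - <;> rfl
  rw [h1, Fintype.sum_sum_type]
  rfl

/-- The weighted Laplacian with edge weights `c`, with the row and column of `ρ` removed. -/
def lap [Fintype Λ] [DecidableEq Λ] (o : Orientation Λ) (c : Edge Λ → ℝ) : Matrix Λ Λ ℝ :=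
  F o * Matrix.diagonal c * (F o).transpose

/-- The factor `e^{u_i + u_j}` of an edge `{i, j}`. -/
def expW (o : Orientation Λ) (u : Λ → ℝ) (e : Edge Λ) : ℝ :=
  Real.exp (ext u (o.plus e) + ext u (o.minus e))

theorem expW_pos (o : Orientation Λ) (u : Λ → ℝ) (e : Edge Λ) : 0 < expW o u e := Real.exp_pos _

section
variable [Fintype Λ] [DecidableEq Λ] (o : Orientation Λ)

theorem lap_apply (c : Edge Λ → ℝ) (i j : Λ) : lap o c i j = ∑ e, c e * (F o i e * F o j e) := by
  rw [lap, Matrix.mul_apply]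
  simp only [Matrix.mul_diagonal, Matrix.transpose_apply]
  exact Finset.sum_congr rfl fun e _ => by ring

theorem F_transpose_mulVec (x : Λ → ℝ) (e : Edge Λ) :
    ((F o).transpose.mulVec x) e = ext x (o.plus e) - ext x (o.minus e) := by
  have h : ∀ v : Option Λ, ∑ i, (if v = some i then (1:ℝ) else 0) * x i = ext x v := by
    intro v
    cases v with
    | none => simp [ext]
    | some k => simp [ext]
  simp only [Matrix.mulVec, dotProduct, Matrix.transpose_apply, F, Matrix.of_apply, sub_mul,
    Finset.sum_sub_distrib, h]

theorem dotProduct_lap_mulVec (c : Edge Λ → ℝ) (x : Λ → ℝ) :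
    x ⬝ᵥ (lap o c).mulVec x = ∑ e, c e * (ext x (o.plus e) - ext x (o.minus e)) ^ 2 := by
  have h : x ⬝ᵥ (lap o c).mulVec x =
      (F o).transpose.mulVec x ⬝ᵥ (Matrix.diagonal c).mulVec ((F o).transpose.mulVec x) := by
    simp only [lap]
    rw [← Matrix.mulVec_mulVec, ← Matrix.mulVec_mulVec, Matrix.dotProduct_mulVec,
      ← Matrix.mulVec_transpose]
  rw [h]
  simp only [dotProduct, Matrix.mulVec_diagonal, F_transpose_mulVec]
  exact Finset.sum_congr rfl fun e _ => by ring

theorem D_eq_lap (W : Edge Λ → ℝ) (u : Λ → ℝ) : D W u = lap o (fun e => W e * expW o u e) := by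
  ext i j
  set g : Option Λ → Option Λ → ℝ := fun a b => weight W a b * Real.exp (ext u a + ext u b)
    with hg
  have gcomm : ∀ a b, g a b = g b a := fun a b => by
    simp only [hg]; rw [weight_comm, add_comm]
  set χ : Λ → Option Λ → ℝ := fun i a => if a = some i then 1 else 0 with hχ
  have h1 := sum_pairs_eq_sum_edges o
    (fun a b => 1 / 2 * g a b * ((χ i a - χ i b) * (χ j a - χ j b))) (by intro a; simp)
  have h2 : lap o (fun e => W e * expW o u e) i j = ∑ e, (1 / 2 * g (o.plus e) (o.minus e) *
      ((χ i (o.plus e) - χ i (o.minus e)) * (χ j (o.plus e) - χ j (o.minus e))) +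
      1 / 2 * g (o.minus e) (o.plus e) *
      ((χ i (o.minus e) - χ i (o.plus e)) * (χ j (o.minus e) - χ j (o.plus e)))) := by
    rw [lap_apply]
    refine Finset.sum_congr rfl fun e _ => ?_
    rw [gcomm (o.minus e)]
    simp only [hg, hχ, weight_eq, expW, F, Matrix.of_apply]
    ring
  rw [h2, ← h1]
  have e1 : ∀ (f : Option Λ → ℝ) (k : Λ), ∑ a, f a * χ k a = f (some k) := by
    intro f k
    simp [hχ]
  have h3 : ∑ a, ∑ b, 1 / 2 * g a b * ((χ i a - χ i b) * (χ j a - χ j b)) =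
      (∑ b, g (some i) b) * (if i = j then 1 else 0) - g (some i) (some j) := by
    have h4 : ∀ a b, 1 / 2 * g a b * ((χ i a - χ i b) * (χ j a - χ j b)) =
        1 / 2 * (g a b * χ j a * χ i a) - 1 / 2 * (g a b * χ j b * χ i a)
         - 1 / 2 * (g a b * χ i b * χ j a) + 1 / 2 * (g a b * χ j b * χ i b) := by
      intro a b; ring
    have h5 : ∑ a, ∑ b, g a b * χ j a * χ i a = (∑ b, g (some i) b) * χ j (some i) := by
      rw [Finset.sum_comm]
      simp only [e1 (fun a => g a _ * χ j a) i]
      rw [Finset.sum_mul]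
    have h6 : ∀ i j, ∑ a, ∑ b, g a b * χ j b * χ i a = g (some i) (some j) := by
      intro i j
      simp only [← Finset.sum_mul, e1]
    have h7 : ∑ a, ∑ b, g a b * χ j b * χ i b = (∑ b, g (some i) b) * χ j (some i) := by
      rw [← h5, Finset.sum_comm]
      refine Finset.sum_congr rfl fun a _ => Finset.sum_congr rfl fun b _ => ?_
      rw [gcomm]
    simp only [h4, Finset.sum_add_distrib, Finset.sum_sub_distrib, ← Finset.mul_sum]
    rw [h5, h6, h6, h7, gcomm (some j) (some i)]
    have : χ j (some i) = if i = j then 1 else 0 := by simp [hχ]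
    rw [this]; ring
  rw [h3]
  by_cases hij : i = j
  · subst hij
    simp [D, hg, weight_self]
  · simp [D, hg, hij]

theorem lap_isHermitian (c : Edge Λ → ℝ) : (lap o c).IsHermitian := by
  ext i j
  simp only [Matrix.conjTranspose_apply, lap_apply, star_trivial]
  exact Finset.sum_congr rfl fun e _ => by ring

theorem lap_posSemidef {c : Edge Λ → ℝ} (hc : ∀ e, 0 ≤ c e) : (lap o c).PosSemidef := by
  refine Matrix.PosSemidef.of_dotProduct_mulVec_nonneg (lap_isHermitian o c) fun x => ?_
  rw [star_trivial, dotProduct_lap_mulVec]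
  exact Finset.sum_nonneg fun e _ => mul_nonneg (hc e) (sq_nonneg _)

/-- A Laplacian is positive definite if its weights are positive along a connected graph: a field
of zero energy is constant along edges, hence equal to its value `0` at `ρ`. -/
theorem lap_posDef {W c : Edge Λ → ℝ} (hconn : (graphPlus W).Connected) (hc : ∀ e, 0 ≤ c e)
    (hWc : ∀ e, 0 < W e → 0 < c e) : (lap o c).PosDef := by
  refine Matrix.PosDef.of_dotProduct_mulVec_pos (lap_isHermitian o c) fun x hx => ?_
  rw [star_trivial, dotProduct_lap_mulVec]
  have hnn : ∀ e ∈ Finset.univ, 0 ≤ c e * (ext x (o.plus e) - ext x (o.minus e)) ^ 2 :=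
    fun e _ => mul_nonneg (hc e) (sq_nonneg _)
  refine lt_of_le_of_ne (Finset.sum_nonneg hnn) fun h0 => hx ?_
  have h1 := (Finset.sum_eq_zero_iff_of_nonneg hnn).1 h0.symm
  have h2 : ∀ i j, (graphPlus W).Adj i j → ext x i = ext x j := by
    intro i j hij
    have hne := hij.ne
    have hW : 0 < W ⟨s(i, j), by simpa using hne⟩ := by
      have : 0 < weight W i j := hij
      rwa [weight, dif_neg hne] at this
    have h3 := h1 ⟨s(i, j), by simpa using hne⟩ (Finset.mem_univ _)
    have h4 := sq_eq_zero_iff.1 ((mul_eq_zero.1 h3).resolve_left (hWc _ hW).ne')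
    have he := o.mk_eq ⟨s(i, j), by simpa using hne⟩
    simp only [Sym2.eq_iff] at he
    rcases he with he | he <;> rw [he.1, he.2] at h4 <;> linarith
  funext i
  obtain ⟨p⟩ := hconn.preconnected (some i) none
  have h3 : ∀ {a b : Option Λ}, (graphPlus W).Walk a b → ext x a = ext x b := by
    intro a b p
    induction p with
    | nil => rfl
    | cons h _ ih => exact (h2 _ _ h).trans ih
  exact h3 p

/-- The determinant of a matrix is affine along a rank-one perturbation. -/
theorem det_add_smul_vecMulVec {n : Type*} [Fintype n] [DecidableEq n] (A : Matrix n n ℝ)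
    (v w : n → ℝ) (t : ℝ) : (A + t • Matrix.vecMulVec v w).det =
      A.det + t * ((A + Matrix.vecMulVec v w).det - A.det) := by
  -- As a Schur complement, the determinant is linear in the column `z` of a bordered matrix.
  have key : ∀ z : n → ℝ, (A + Matrix.vecMulVec z w).det =
      (Matrix.fromBlocks A (-Matrix.replicateCol Unit z) (Matrix.replicateRow Unit w) 1).det := by
    intro z
    rw [Matrix.det_fromBlocks_one₂₂]
    congr 1
    ext i j
    simp [Matrix.vecMulVec, Matrix.mul_apply]
  have h2 : ∀ z : n → ℝ,
      Matrix.fromBlocks A (-Matrix.replicateCol Unit z) (Matrix.replicateRow Unit w) 1 =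
      (Matrix.fromBlocks A 0 (Matrix.replicateRow Unit w) 1).updateCol (Sum.inr ())
        (Sum.elim (0 : n → ℝ) (fun _ : Unit => (1 : ℝ)) + (-1 : ℝ) • Sum.elim z 0) := by
    intro z
    ext i j
    rcases i with i | i <;> rcases j with j | j <;> simp
  have h3 : ∀ z : n → ℝ, (A + Matrix.vecMulVec z w).det =
      A.det - ((Matrix.fromBlocks A 0 (Matrix.replicateRow Unit w) 1).updateCol (Sum.inr ())
        (Sum.elim z 0)).det := by
    intro z
    rw [key, h2, Matrix.det_updateCol_add, Matrix.det_updateCol_smul, neg_one_mul, ← sub_eq_add_neg]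
    congr 1
    have := h2 0
    rw [show Sum.elim (0 : n → ℝ) (0 : Unit → ℝ) = 0 by ext i; cases i <;> rfl, smul_zero,
      add_zero] at this
    rw [← this, ← key]
    simp
  rw [← Matrix.smul_vecMulVec, h3, h3]
  rw [show Sum.elim (t • v) (0 : Unit → ℝ) = t • Sum.elim v 0 by ext i; cases i <;> simp,
    Matrix.det_updateCol_smul]
  ring

theorem lap_update (c : Edge Λ → ℝ) (e : Edge Λ) (t : ℝ) :
    lap o (Function.update c e t) = lap o (Function.update c e 0) +
      t • Matrix.vecMulVec (fun i => F o i e) (fun i => F o i e) := by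
  ext i j
  simp only [lap_apply, Matrix.add_apply, Matrix.smul_apply, Matrix.vecMulVec_apply, smul_eq_mul]
  rw [← Finset.add_sum_erase _ _ (Finset.mem_univ e), ← Finset.add_sum_erase _ _ (Finset.mem_univ e)]
  have : ∀ t : ℝ, ∑ x ∈ Finset.univ.erase e, Function.update c e t x * (F o i x * F o j x) =
      ∑ x ∈ Finset.univ.erase e, c x * (F o i x * F o j x) := by
    intro t
    refine Finset.sum_congr rfl fun x hx => ?_
    rw [Function.update_of_ne (Finset.ne_of_mem_erase hx)]
  rw [this, this]
  simp
  ring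

/-- The determinant of the Laplacian is affine in the weight of each edge. -/
theorem det_lap_update (c : Edge Λ → ℝ) (e : Edge Λ) (t a : ℝ) :
    (lap o (Function.update c e (t * a))).det = (lap o (Function.update c e 0)).det +
      t * ((lap o (Function.update c e a)).det - (lap o (Function.update c e 0)).det) := by
  rw [lap_update o c e (t * a), mul_smul, ← Matrix.smul_vecMulVec, ← Matrix.smul_vecMulVec]
  rw [lap_update o c e a, ← Matrix.smul_vecMulVec]
  rw [Matrix.smul_vecMulVec, det_add_smul_vecMulVec]

/-- Scaling down nonnegative edge weights costs at most the product of the scaling factors: the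
determinant is affine in each weight, with a nonnegative value at weight `0`. -/
theorem prod_mul_det_lap_le {c t : Edge Λ → ℝ} (hc : ∀ e, 0 ≤ c e) (h0 : ∀ e, 0 ≤ t e)
    (h1 : ∀ e, t e ≤ 1) : (∏ e, t e) * (lap o c).det ≤ (lap o (fun e => t e * c e)).det := by
  have key : ∀ S : Finset (Edge Λ), (∏ e ∈ S, t e) * (lap o c).det ≤
      (lap o (fun e => if e ∈ S then t e * c e else c e)).det := by
    intro S
    induction S using Finset.induction_on with
    | empty => simp
    | insert a S ha ih =>
      set c' : Edge Λ → ℝ := fun e => if e ∈ S then t e * c e else c e with hc'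
      have hu : (fun e => if e ∈ insert a S then t e * c e else c e) =
          Function.update c' a (t a * c a) := by
        funext e
        by_cases he : e = a
        · subst he; simp
        · simp [hc', he]
      have hu2 : c' = Function.update c' a (c a) := by
        rw [eq_comm, Function.update_eq_iff]
        simp [hc', ha]
      rw [hu, det_lap_update, ← hu2, Finset.prod_insert ha]
      have hnn : 0 ≤ (lap o (Function.update c' a 0)).det := by
        refine (lap_posSemidef o fun e => ?_).det_nonneg
        by_cases he : e = a
        · subst he; simp
        · rw [Function.update_of_ne he]
          simp only [hc']
          split_ifs
          · exact mul_nonneg (h0 e) (hc e)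
          · exact hc e
      nlinarith [mul_le_mul_of_nonneg_left ih (h0 a), mul_nonneg (sub_nonneg.2 (h1 a)) hnn]
  simpa using key Finset.univ

end

end

/-! ### Growth bounds and integrability -/

section
variable {Λ : Type*}

theorem one_le_B (u s : Λ → ℝ) (i j : Option Λ) : 1 ≤ B u s i j := by
  unfold B
  have := Real.one_le_cosh (ext u i - ext u j)
  have : 0 ≤ 1 / 2 * (ext s i - ext s j) ^ 2 * Real.exp (ext u i + ext u j) := by positivity
  linarith

theorem one_le_edgeB (u s : Λ → ℝ) (e : Edge Λ) : 1 ≤ edgeB u s e := by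
  obtain ⟨e, he⟩ := e
  induction e with
  | h i j => exact one_le_B u s i j

theorem edgeB_pos (u s : Λ → ℝ) (e : Edge Λ) : 0 < edgeB u s e :=
  zero_lt_one.trans_le (one_le_edgeB u s e)

theorem cosh_le_edgeB (o : Orientation Λ) (u s : Λ → ℝ) (e : Edge Λ) :
    Real.cosh (ext u (o.plus e) - ext u (o.minus e)) ≤ edgeB u s e := by
  rw [edgeB_eq o, B]
  exact le_add_of_nonneg_right (by positivity)

theorem prod_cosh_le_prod_edgeB (o : Orientation Λ) {m : Edge Λ → ℝ} (hm : ∀ e, 0 ≤ m e)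
    (S : Finset (Edge Λ)) (u s : Λ → ℝ) :
    ∏ e ∈ S, Real.cosh (ext u (o.plus e) - ext u (o.minus e)) ^ m e ≤
      ∏ e ∈ S, edgeB u s e ^ m e :=
  Finset.prod_le_prod (fun _ _ => Real.rpow_nonneg (Real.cosh_pos _).le _)
    fun e _ => Real.rpow_le_rpow (Real.cosh_pos _).le (cosh_le_edgeB o u s e) (hm e)

/-- In upper half-space coordinates `(s, a)` with `a = e^{-u}`, `B` is the hyperbolic cosine of the
distance; it satisfies a multiplicative triangle inequality. -/
theorem B_le_two_mul (u s : Λ → ℝ) (i j k : Option Λ) :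
    B u s i j ≤ 2 * (B u s i k * B u s k j) := by
  have hB : ∀ i j, B u s i j * (2 * (Real.exp (-ext u i) * Real.exp (-ext u j))) =
      Real.exp (-ext u i) ^ 2 + Real.exp (-ext u j) ^ 2 + (ext s i - ext s j) ^ 2 := by
    intro i j
    have h1 : Real.exp (ext u i) * Real.exp (-ext u i) = 1 := by rw [← Real.exp_add]; simp
    have h2 : Real.exp (ext u j) * Real.exp (-ext u j) = 1 := by rw [← Real.exp_add]; simp
    rw [B, Real.cosh_eq, neg_sub, sub_eq_add_neg, sub_eq_add_neg (ext u j), Real.exp_add,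
      Real.exp_add, Real.exp_add]
    linear_combination (Real.exp (-ext u j) ^ 2 + (ext s i - ext s j) ^ 2 *
      (Real.exp (ext u j) * Real.exp (-ext u j))) * h1 +
      (Real.exp (-ext u i) ^ 2 + (ext s i - ext s j) ^ 2) * h2
  have h1 := hB i j
  have h2 := hB i k
  have h3 := hB k j
  set a := Real.exp (-ext u i)
  set b := Real.exp (-ext u j)
  set c := Real.exp (-ext u k)
  have ha : 0 < a := Real.exp_pos _
  have hb : 0 < b := Real.exp_pos _
  have hc : 0 < c := Real.exp_pos _
  set x := ext s i - ext s k
  set y := ext s k - ext s j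
  have hxy : ext s i - ext s j = x + y := by simp only [x, y]; ring
  rw [hxy] at h1
  refine le_of_mul_le_mul_right ?_ (show 0 < 2 * (a * b) * c ^ 2 by positivity)
  have e1 : B u s i j * (2 * (a * b) * c ^ 2) = (a ^ 2 + b ^ 2 + (x + y) ^ 2) * c ^ 2 := by
    rw [← h1]; ring
  have e2 : 2 * (B u s i k * B u s k j) * (2 * (a * b) * c ^ 2) =
      (a ^ 2 + c ^ 2 + x ^ 2) * (c ^ 2 + b ^ 2 + y ^ 2) := by
    rw [← h2, ← h3]; ring
  rw [e1, e2]
  nlinarith [sq_nonneg (c ^ 2 - x * y), sq_nonneg (a * b), sq_nonneg (a * y), sq_nonneg (x * b)]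

theorem exp_abs_le_B (u s : Λ → ℝ) (i : Option Λ) : Real.exp |ext u i| ≤ 2 * B u s i none := by
  have h1 : Real.cosh (ext u i) ≤ B u s i none := by
    have : 0 ≤ 1 / 2 * (ext s i - ext s none) ^ 2 * Real.exp (ext u i + ext u none) := by
      positivity
    have h0 : ext u none = 0 := rfl
    rw [B]
    rw [h0] at this ⊢
    rw [sub_zero]; linarith
  have h2 : Real.exp |ext u i| ≤ 2 * Real.cosh (ext u i) := by
    rw [← Real.cosh_abs, Real.cosh_eq]
    have := Real.exp_pos (-|ext u i|)
    linarith
  linarith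

theorem exp_abs_mul_le_B_pow (u s : Λ → ℝ) (i : Λ) :
    Real.exp |u i| * (1 + s i ^ 2) ≤ 8 * B u s (some i) none ^ 3 := by
  have h1 := exp_abs_le_B u s (some i)
  have h2 : 1 + s i ^ 2 ≤ 2 * B u s (some i) none * Real.exp |u i| := by
    have e1 : B u s (some i) none = Real.cosh (u i) + 1 / 2 * s i ^ 2 * Real.exp (u i) := by
      simp [B, ext]
    have h3 : Real.exp (-|u i|) ≤ Real.exp (u i) := Real.exp_le_exp.2 (neg_abs_le _)
    have h4 : Real.exp (-|u i|) * Real.exp |u i| = 1 := by rw [← Real.exp_add]; simp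
    have h5 : 1 ≤ Real.exp |u i| := Real.one_le_exp (abs_nonneg _)
    have h6 := Real.one_le_cosh (u i)
    have h7 : 1 ≤ Real.exp (u i) * Real.exp |u i| := by
      rw [← h4]; exact mul_le_mul_of_nonneg_right h3 (by positivity)
    rw [e1]
    nlinarith [mul_le_mul_of_nonneg_left h7 (sq_nonneg (s i)),
      mul_le_mul h6 h5 zero_le_one (by positivity)]
  have h0 : (0:ℝ) < Real.exp |u i| := Real.exp_pos _
  have hB := one_le_B u s (some i) none
  have h1' : Real.exp |u i| ≤ 2 * B u s (some i) none := h1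
  calc Real.exp |u i| * (1 + s i ^ 2)
      ≤ Real.exp |u i| * (2 * B u s (some i) none * Real.exp |u i|) := by gcongr
    _ ≤ (2 * B u s (some i) none) * (2 * B u s (some i) none * (2 * B u s (some i) none)) := by
        gcongr
    _ = 8 * B u s (some i) none ^ 3 := by ring

section
variable [Fintype Λ]

/-- The product of the pinning terms `B_{iρ}`, used to measure growth in `(u, s)`. -/
def pinB (p : (Λ → ℝ) × (Λ → ℝ)) : ℝ := ∏ i : Λ, B p.1 p.2 (some i) none

theorem one_le_pinB (p : (Λ → ℝ) × (Λ → ℝ)) : 1 ≤ pinB p :=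
  Finset.one_le_prod fun _ _ => one_le_B _ _ _ _

theorem B_none_le_pinB (p : (Λ → ℝ) × (Λ → ℝ)) (i : Option Λ) : B p.1 p.2 i none ≤ pinB p := by
  classical
  cases i with
  | none =>
    have : B p.1 p.2 none none = 1 := by simp [B]
    rw [this]; exact one_le_pinB p
  | some k =>
    unfold pinB
    rw [← Finset.mul_prod_erase _ _ (Finset.mem_univ k)]
    exact le_mul_of_one_le_right (zero_le_one.trans (one_le_B _ _ _ _)) 
      (Finset.one_le_prod fun _ _ => one_le_B _ _ _ _)

/-- A function of `(u, s)` is of polynomial growth if it is bounded by a constant times a power of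
`∏_i B_{iρ}`. -/
def PolyGrowth (f : (Λ → ℝ) × (Λ → ℝ) → ℝ) : Prop :=
  ∃ (C : ℝ) (N : ℕ), 0 ≤ C ∧ ∀ p, |f p| ≤ C * pinB p ^ N

namespace PolyGrowth

variable {f g : (Λ → ℝ) × (Λ → ℝ) → ℝ}

theorem mono (hg : PolyGrowth g) (h : ∀ p, |f p| ≤ |g p|) : PolyGrowth f := by
  obtain ⟨C, N, h0, hC⟩ := hg
  exact ⟨C, N, h0, fun p => (h p).trans (hC p)⟩

theorem const (c : ℝ) : PolyGrowth (fun _ : (Λ → ℝ) × (Λ → ℝ) => c) :=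
  ⟨|c|, 0, abs_nonneg _, fun p => by simp⟩

theorem mul (hf : PolyGrowth f) (hg : PolyGrowth g) : PolyGrowth (fun p => f p * g p) := by
  obtain ⟨C, N, h0, hC⟩ := hf
  obtain ⟨C', N', h0', hC'⟩ := hg
  refine ⟨C * C', N + N', mul_nonneg h0 h0', fun p => ?_⟩
  rw [abs_mul, pow_add]
  calc |f p| * |g p| ≤ (C * pinB p ^ N) * (C' * pinB p ^ N') :=
        mul_le_mul (hC p) (hC' p) (abs_nonneg _) ((abs_nonneg _).trans (hC p))
    _ = _ := by ring

theorem add (hf : PolyGrowth f) (hg : PolyGrowth g) : PolyGrowth (fun p => f p + g p) := by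
  obtain ⟨C, N, h0, hC⟩ := hf
  obtain ⟨C', N', h0', hC'⟩ := hg
  refine ⟨C + C', N + N', add_nonneg h0 h0', fun p => ?_⟩
  have h1 := one_le_pinB p
  calc |f p + g p| ≤ |f p| + |g p| := abs_add_le _ _
    _ ≤ C * pinB p ^ N + C' * pinB p ^ N' := add_le_add (hC p) (hC' p)
    _ ≤ C * pinB p ^ (N + N') + C' * pinB p ^ (N + N') := by
        gcongr <;> first | exact h1 | omega
    _ = _ := by ring

theorem neg (hf : PolyGrowth f) : PolyGrowth (fun p => - f p) := hf.mono fun p => by simp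

theorem sub (hf : PolyGrowth f) (hg : PolyGrowth g) : PolyGrowth (fun p => f p - g p) := by
  simpa only [sub_eq_add_neg] using hf.add hg.neg

theorem pow (hf : PolyGrowth f) (n : ℕ) : PolyGrowth (fun p => f p ^ n) := by
  induction n with
  | zero => simpa using const 1
  | succ n ih => simpa only [pow_succ] using ih.mul hf

theorem sum {ι : Type*} (S : Finset ι) {f : ι → (Λ → ℝ) × (Λ → ℝ) → ℝ}
    (hf : ∀ i, PolyGrowth (f i)) : PolyGrowth (fun p => ∑ i ∈ S, f i p) := by
  classical
  induction S using Finset.induction_on with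
  | empty => simpa using const 0
  | insert a S ha ih => simpa only [Finset.sum_insert ha] using (hf a).add ih

theorem prod {ι : Type*} (S : Finset ι) {f : ι → (Λ → ℝ) × (Λ → ℝ) → ℝ}
    (hf : ∀ i, PolyGrowth (f i)) : PolyGrowth (fun p => ∏ i ∈ S, f i p) := by
  classical
  induction S using Finset.induction_on with
  | empty => simpa using const 1
  | insert a S ha ih => simpa only [Finset.prod_insert ha] using (hf a).mul ih

theorem det {n : Type*} [Fintype n] [DecidableEq n] {A : (Λ → ℝ) × (Λ → ℝ) → Matrix n n ℝ}
    (hA : ∀ i j, PolyGrowth fun p => A p i j) : PolyGrowth (fun p => (A p).det) := by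
  simp only [Matrix.det_apply']
  exact sum _ fun σ => (const _).mul (prod _ fun i => hA _ _)

end PolyGrowth

theorem polyGrowth_B (i j : Option Λ) : PolyGrowth fun p : (Λ → ℝ) × (Λ → ℝ) => B p.1 p.2 i j := by
  refine ⟨2, 2, by norm_num, fun p => ?_⟩
  have h1 := one_le_B p.1 p.2 i j
  rw [abs_of_nonneg (by linarith)]
  refine (B_le_two_mul p.1 p.2 i j none).trans ?_
  rw [B_comm _ _ none j, sq]
  have h2 := one_le_B p.1 p.2 j none
  have h3 := one_le_pinB p
  gcongr <;> exact B_none_le_pinB p _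

theorem polyGrowth_edgeB (e : Edge Λ) :
    PolyGrowth fun p : (Λ → ℝ) × (Λ → ℝ) => edgeB p.1 p.2 e := by
  obtain ⟨e, he⟩ := e
  induction e with
  | h i j => exact polyGrowth_B i j

theorem polyGrowth_edgeB_rpow (e : Edge Λ) (m : ℝ) :
    PolyGrowth fun p : (Λ → ℝ) × (Λ → ℝ) => edgeB p.1 p.2 e ^ m := by
  refine ((polyGrowth_edgeB e).pow ⌈m⌉₊).mono fun p => ?_
  have h1 := one_le_edgeB p.1 p.2 e
  rw [abs_of_nonneg (by positivity), abs_of_nonneg (by positivity), ← Real.rpow_natCast]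
  exact Real.rpow_le_rpow_of_exponent_le h1 (Nat.le_ceil m)

theorem polyGrowth_exp (i : Option Λ) :
    PolyGrowth fun p : (Λ → ℝ) × (Λ → ℝ) => Real.exp (ext p.1 i) := by
  refine ((PolyGrowth.const 2).mul (polyGrowth_B i none)).mono fun p => ?_
  have h1 := one_le_B p.1 p.2 i none
  rw [abs_of_pos (Real.exp_pos _), abs_of_nonneg (by positivity)]
  exact (Real.exp_le_exp.2 (le_abs_self _)).trans (exp_abs_le_B p.1 p.2 i)

theorem polyGrowth_exp_neg (i : Λ) :
    PolyGrowth fun p : (Λ → ℝ) × (Λ → ℝ) => Real.exp (- p.1 i) := by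
  refine ((PolyGrowth.const 2).mul (polyGrowth_B (some i) none)).mono fun p => ?_
  have h1 := one_le_B p.1 p.2 (some i) none
  rw [abs_of_pos (Real.exp_pos _), abs_of_nonneg (by positivity)]
  exact (Real.exp_le_exp.2 (neg_le_abs _)).trans (exp_abs_le_B p.1 p.2 (some i))

theorem polyGrowth_expW (o : Orientation Λ) (e : Edge Λ) :
    PolyGrowth fun p : (Λ → ℝ) × (Λ → ℝ) => expW o p.1 e := by
  simp only [expW, Real.exp_add]
  exact (polyGrowth_exp _).mul (polyGrowth_exp _)

/-- The energy `∑_e W_e B_e`. -/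
def energy [DecidableEq Λ] (W : Edge Λ → ℝ) (p : (Λ → ℝ) × (Λ → ℝ)) : ℝ :=
  ∑ e, W e * edgeB p.1 p.2 e

variable [DecidableEq Λ]

theorem energy_nonneg {W : Edge Λ → ℝ} (hW : ∀ e, 0 ≤ W e) (p : (Λ → ℝ) × (Λ → ℝ)) :
    0 ≤ energy W p :=
  Finset.sum_nonneg fun e _ => mul_nonneg (hW e) (edgeB_pos _ _ e).le

/-- Along a path of edges of positive weight, the pinning terms are controlled by the energy. -/
theorem exists_B_none_le {W : Edge Λ → ℝ} (hW : ∀ e, 0 ≤ W e) (hconn : (graphPlus W).Connected)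
    (i : Option Λ) : ∃ (C : ℝ) (K : ℕ), 0 ≤ C ∧
      ∀ p : (Λ → ℝ) × (Λ → ℝ), B p.1 p.2 i none ≤ C * (1 + energy W p) ^ K := by
  obtain ⟨w⟩ := hconn.preconnected i none
  have key : ∀ {a b : Option Λ}, (graphPlus W).Walk a b → ∃ (C : ℝ) (K : ℕ), 0 ≤ C ∧
      ∀ p : (Λ → ℝ) × (Λ → ℝ), B p.1 p.2 a b ≤ C * (1 + energy W p) ^ K := by
    intro a b w
    induction w with
    | nil => exact ⟨1, 0, zero_le_one, fun p => by simp [B]⟩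
    | @cons a c b h _ ih =>
      obtain ⟨C, K, h0, hC⟩ := ih
      have hne := h.ne
      have hWp : 0 < W ⟨s(a, c), by simpa using hne⟩ := by
        have : 0 < weight W a c := h
        rwa [weight, dif_neg hne] at this
      refine ⟨2 * ((W ⟨s(a, c), by simpa using hne⟩)⁻¹ * C), K + 1, by positivity, fun p => ?_⟩
      have hE := energy_nonneg hW p
      have h1 : B p.1 p.2 a c ≤ (W ⟨s(a, c), by simpa using hne⟩)⁻¹ * (1 + energy W p) := by
        rw [le_inv_mul_iff₀ hWp]
        have := Finset.single_le_sum (f := fun e => W e * edgeB p.1 p.2 e)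
          (fun e _ => mul_nonneg (hW e) (edgeB_pos _ _ e).le)
          (Finset.mem_univ (⟨s(a, c), by simpa using hne⟩ : Edge Λ))
        refine this.trans ?_
        change energy W p ≤ _
        linarith
      have h2 := one_le_B p.1 p.2 c b
      calc B p.1 p.2 a b ≤ 2 * (B p.1 p.2 a c * B p.1 p.2 c b) := B_le_two_mul _ _ _ _ _
        _ ≤ 2 * (((W ⟨s(a, c), by simpa using hne⟩)⁻¹ * (1 + energy W p)) *
            (C * (1 + energy W p) ^ K)) := by
          gcongr
          exact hC p
        _ = _ := by ring
  exact key w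

theorem exists_pinB_le {W : Edge Λ → ℝ} (hW : ∀ e, 0 ≤ W e) (hconn : (graphPlus W).Connected) :
    ∃ (C : ℝ) (K : ℕ), 0 ≤ C ∧ ∀ p, pinB p ≤ C * (1 + energy W p) ^ K := by
  choose C K h0 h using fun i : Λ => exists_B_none_le hW hconn (some i)
  refine ⟨∏ i, C i, ∑ i, K i, Finset.prod_nonneg fun i _ => h0 i, fun p => ?_⟩
  rw [← Finset.prod_pow_eq_pow_sum, ← Finset.prod_mul_distrib]
  exact Finset.prod_le_prod (fun i _ => zero_le_one.trans (one_le_B _ _ _ _)) fun i _ => h i p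

/-- The exponential of the energy beats every power of the pinning terms. -/
theorem exists_pinB_pow_mul_exp_le {W : Edge Λ → ℝ} (hW : ∀ e, 0 ≤ W e)
    (hconn : (graphPlus W).Connected) (N : ℕ) :
    ∃ C : ℝ, 0 ≤ C ∧ ∀ p, pinB p ^ N * Real.exp (- energy W p) ≤ C := by
  obtain ⟨C, K, h0, h⟩ := exists_pinB_le hW hconn
  refine ⟨C ^ N * ((K * N).factorial * Real.exp 1), by positivity, fun p => ?_⟩
  have hE := energy_nonneg hW p
  have h1 : (1 + energy W p) ^ (K * N) ≤ (K * N).factorial * Real.exp (1 + energy W p) := by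
    have := Real.pow_div_factorial_le_exp (1 + energy W p) (by linarith) (K * N)
    rwa [div_le_iff₀' (by positivity)] at this
  have h2 := one_le_pinB p
  calc pinB p ^ N * Real.exp (- energy W p)
      ≤ (C * (1 + energy W p) ^ K) ^ N * Real.exp (- energy W p) := by
        gcongr
        exact h p
    _ = C ^ N * ((1 + energy W p) ^ (K * N) * Real.exp (- energy W p)) := by
        rw [mul_pow, ← pow_mul]; ring
    _ ≤ C ^ N * (((K * N).factorial * Real.exp (1 + energy W p)) * Real.exp (- energy W p)) := by
        gcongr
    _ = _ := by
        rw [mul_assoc ((K * N).factorial : ℝ), ← Real.exp_add]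
        ring_nf

theorem integrable_exp_neg_abs : Integrable fun x : ℝ => Real.exp (-|x|) := by
  rw [← integrableOn_univ, ← Set.Iic_union_Ioi (a := (0 : ℝ))]
  refine IntegrableOn.union ?_ ?_
  · exact (integrableOn_exp_Iic 0).congr_fun
      (fun x hx => by rw [abs_of_nonpos hx, neg_neg]) measurableSet_Iic
  · exact (integrableOn_exp_neg_Ioi 0).congr_fun
      (fun x hx => by rw [abs_of_pos hx]) measurableSet_Ioi

/-- A continuous function of polynomial growth is integrable against `exp (- energy)` as soon as
the graph of positive weights is connected. -/
theorem PolyGrowth.integrable {W : Edge Λ → ℝ} (hW : ∀ e, 0 ≤ W e)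
    (hconn : (graphPlus W).Connected) {f : (Λ → ℝ) × (Λ → ℝ) → ℝ} (hf : PolyGrowth f)
    (hfm : AEStronglyMeasurable (fun p => f p * Real.exp (- energy W p)) volume) :
    Integrable (fun p => f p * Real.exp (- energy W p)) := by
  obtain ⟨C, N, h0, h⟩ := hf
  -- Three extra powers of `pinB` dominate `∏ e^{|u_i|} (1 + s_i²)`, whose inverse is integrable.
  obtain ⟨C', h0', h'⟩ := exists_pinB_pow_mul_exp_le hW hconn (N + 3)
  have hint : Integrable (fun p : (Λ → ℝ) × (Λ → ℝ) =>
      (∏ i, Real.exp (-|p.1 i|)) * ∏ i, (1 + p.2 i ^ 2)⁻¹) := by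
    exact Integrable.mul_prod (f := fun x : Λ → ℝ => ∏ i, Real.exp (-|x i|))
      (g := fun x : Λ → ℝ => ∏ i, (1 + x i ^ 2)⁻¹)
      (Integrable.fintype_prod fun i => integrable_exp_neg_abs)
      (Integrable.fintype_prod fun i => integrable_inv_one_add_sq)
  refine (hint.const_mul (C * C' * ∏ _i : Λ, 8)).mono' hfm (Filter.Eventually.of_forall fun p => ?_)
  rw [Real.norm_eq_abs, abs_mul, abs_of_pos (Real.exp_pos _)]
  have h1 : ∏ i : Λ, (Real.exp |p.1 i| * (1 + p.2 i ^ 2)) ≤ (∏ _i : Λ, 8) * pinB p ^ 3 := by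
    unfold pinB
    rw [← Finset.prod_pow, ← Finset.prod_mul_distrib]
    exact Finset.prod_le_prod (fun i _ => by positivity)
      fun i _ => exp_abs_mul_le_B_pow p.1 p.2 i
  have h2 : (∏ i : Λ, (Real.exp |p.1 i| * (1 + p.2 i ^ 2))) *
      ((∏ i, Real.exp (-|p.1 i|)) * ∏ i, (1 + p.2 i ^ 2)⁻¹) = 1 := by
    rw [← Finset.prod_mul_distrib, ← Finset.prod_mul_distrib]
    refine Finset.prod_eq_one fun i _ => ?_
    have : (1 + p.2 i ^ 2) ≠ 0 := by positivity
    rw [Real.exp_neg]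
    field_simp
  set T := (∏ i, Real.exp (-|p.1 i|)) * ∏ i, (1 + p.2 i ^ 2)⁻¹ with hT
  have hT0 : 0 ≤ T := mul_nonneg (Finset.prod_nonneg fun i _ => by positivity)
    (Finset.prod_nonneg fun i _ => by positivity)
  have hP := one_le_pinB p
  calc |f p| * Real.exp (- energy W p) ≤ C * pinB p ^ N * Real.exp (- energy W p) := by
        gcongr; exact h p
    _ = (C * pinB p ^ N * Real.exp (- energy W p)) *
          ((∏ i : Λ, (Real.exp |p.1 i| * (1 + p.2 i ^ 2))) * T) := by rw [h2, mul_one]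
    _ ≤ (C * pinB p ^ N * Real.exp (- energy W p)) * (((∏ _i : Λ, 8) * pinB p ^ 3) * T) := by
        gcongr
    _ = C * (pinB p ^ (N + 3) * Real.exp (- energy W p)) * (∏ _i : Λ, 8) * T := by ring
    _ ≤ C * C' * (∏ _i : Λ, 8) * T := by
        gcongr
        exact h' p

end

end

/-! ### From exponentials to powers times exponentials -/

section

section
variable {Ω : Type*} [MeasurableSpace Ω] {μ : Measure Ω} {b X Y : Ω → ℝ} {W C : ℝ}

/-- If the functional `f ↦ ∫ X f(b) - Y f'(b)` equals `C f(1)` on the functions `e^{-w b}`,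
then it does so on the functions `b ^ k e^{-w b}`, by differentiation in `w`. -/
theorem integral_pow_mul_exp_of_exp (hb : ∀ p, 1 ≤ b p) (hbm : Measurable b) (hXm : Measurable X)
    (hYm : Measurable Y) (hW : 0 ≤ W)
    (hX : ∀ N : ℕ, Integrable (fun p => X p * b p ^ N * Real.exp (-(W * b p))) μ)
    (hY : ∀ N : ℕ, Integrable (fun p => Y p * b p ^ N * Real.exp (-(W * b p))) μ)
    (hid : ∀ w, W < w → ∫ p, (X p + Y p * w) * Real.exp (-(w * b p)) ∂μ = C * Real.exp (-w))
    (k : ℕ) : ∀ w, W < w → ∫ p, (X p * b p ^ k + Y p * (w * b p ^ k - k * b p ^ (k - 1))) *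
      Real.exp (-(w * b p)) ∂μ = C * Real.exp (-w) := by
  set Z : ℕ → ℝ → Ω → ℝ := fun k w p =>
    (X p * b p ^ k + Y p * (w * b p ^ k - k * b p ^ (k - 1))) * Real.exp (-(w * b p)) with hZ
  have hZm : ∀ k w, Measurable (Z k w) := fun k w => by simp only [hZ]; fun_prop
  have hbound : ∀ k w R, W < w → w < R → ∀ p, ‖Z k w p‖ ≤
      ‖X p * b p ^ k * Real.exp (-(W * b p))‖ + (R + k) *
        ‖Y p * b p ^ k * Real.exp (-(W * b p))‖ := by
    intro k w R hw hR p
    have hb0 : 0 < b p := zero_lt_one.trans_le (hb p)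
    have he : Real.exp (-(w * b p)) ≤ Real.exp (-(W * b p)) := by
      apply Real.exp_le_exp.2
      have := mul_le_mul_of_nonneg_right hw.le hb0.le
      linarith
    have hw0 : 0 ≤ w := hW.trans hw.le
    have hR0 : 0 ≤ R := hw0.trans hR.le
    have h1 : |w * b p ^ k - k * b p ^ (k - 1)| ≤ (R + k) * b p ^ k := by
      have h2 : b p ^ (k - 1) ≤ b p ^ k := pow_le_pow_right₀ (hb p) (Nat.sub_le _ _)
      have h3 : (0:ℝ) ≤ k * b p ^ (k - 1) := by positivity
      have h4 : (k:ℝ) * b p ^ (k - 1) ≤ k * b p ^ k := by gcongr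
      have h5 : w * b p ^ k ≤ R * b p ^ k := by gcongr
      have h6 : 0 ≤ w * b p ^ k := by positivity
      rw [abs_le]; constructor <;> nlinarith
    simp only [hZ, Real.norm_eq_abs, abs_mul, Real.abs_exp, abs_of_pos (pow_pos hb0 k)]
    calc |X p * b p ^ k + Y p * (w * b p ^ k - k * b p ^ (k - 1))| * Real.exp (-(w * b p))
        ≤ (|X p| * b p ^ k + |Y p| * ((R + k) * b p ^ k)) * Real.exp (-(W * b p)) := by
          refine mul_le_mul ((abs_add_le _ _).trans ?_) he (by positivity) (by positivity)
          rw [abs_mul, abs_mul, abs_of_pos (pow_pos hb0 k)]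
          gcongr
      _ = _ := by ring
  have hbi : ∀ (k : ℕ) (R : ℝ), Integrable (fun p => ‖X p * b p ^ k * Real.exp (-(W * b p))‖ +
      (R + k) * ‖Y p * b p ^ k * Real.exp (-(W * b p))‖) μ :=
    fun k R => ((hX k).norm).add (((hY k).norm).const_mul _)
  have hZi : ∀ k w, W < w → Integrable (Z k w) μ := fun k w hw =>
    (hbi k (w + 1)).mono' (hZm k w).aestronglyMeasurable
      (Filter.Eventually.of_forall (hbound k w (w + 1) hw (by linarith)))
  change ∀ w, W < w → ∫ p, Z k w p ∂μ = C * Real.exp (-w)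
  induction k with
  | zero =>
    intro w hw
    rw [← hid w hw]
    simp [hZ]
  | succ k ih =>
    intro w hw
    -- The `w`-derivative of the integrand for `k` is minus the integrand for `k + 1`.
    have hmem : Set.Ioo W (w + 1) ∈ nhds w := Ioo_mem_nhds hw (by linarith)
    have hder := (hasDerivAt_integral_of_dominated_loc_of_deriv_le (μ := μ) (F := Z k)
      (F' := fun w p => - Z (k + 1) w p) (x₀ := w) hmem
      (Filter.Eventually.of_forall fun x => (hZm k x).aestronglyMeasurable) (hZi k w hw)
      (hZm (k + 1) w).neg.aestronglyMeasurable
      (Filter.Eventually.of_forall fun p x hx => by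
        rw [norm_neg]
        exact hbound (k + 1) x (w + 1) hx.1 hx.2 p)
      (hbi (k + 1) (w + 1))
      (Filter.Eventually.of_forall fun p x hx => by
        simp only [hZ]
        have h1 : HasDerivAt (fun x : ℝ => Real.exp (-(x * b p)))
            (Real.exp (-(x * b p)) * (-(1 * b p))) x :=
          (((hasDerivAt_id x).mul_const (b p)).neg).exp
        have h2 : HasDerivAt (fun x : ℝ => X p * b p ^ k + Y p * (x * b p ^ k - k * b p ^ (k - 1)))
            (Y p * (1 * b p ^ k)) x :=
          ((((hasDerivAt_id x).mul_const _).sub_const _).const_mul _).const_add _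
        convert! h2.mul h1 using 1
        have h3 : (k:ℝ) * b p ^ (k - 1) * b p = k * b p ^ k := by
          cases k with
          | zero => simp
          | succ n => rw [Nat.add_sub_cancel, pow_succ]; ring
        rw [Nat.add_sub_cancel]
        push_cast
        linear_combination (- Y p * Real.exp (-(x * b p))) * h3)).2
    have h1 : HasDerivAt (fun n => ∫ a, Z k n a ∂μ) (C * (Real.exp (-w) * (-1))) w := by
      have h2 : HasDerivAt (fun w : ℝ => C * Real.exp (-w)) (C * (Real.exp (-w) * (-1))) w :=
        ((hasDerivAt_neg w).exp).const_mul C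
      refine h2.congr_of_eventuallyEq ?_
      filter_upwards [hmem] with x hx
      exact ih x hx.1
    have := hder.unique h1
    rw [integral_neg] at this
    linarith

/-- If the functional `f ↦ ∫ X f(b) - Y f'(b)` equals `C f(1)` on the functions `e^{-w b}`, `w > W`,
then it does so on `b ^ m e^{-W b}` for real `m`: this function is a mixture, with respect to a
Gamma density in `t`, of the functions `b ^ k e^{-(W + t) b}` with an integer `k > m`. -/
theorem integral_rpow_mul_exp_of_exp [SigmaFinite μ] (hb : ∀ p, 1 ≤ b p) (hbm : Measurable b)
    (hXm : Measurable X) (hYm : Measurable Y) (hW : 0 ≤ W)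
    (hX : ∀ N : ℕ, Integrable (fun p => X p * b p ^ N * Real.exp (-(W * b p))) μ)
    (hY : ∀ N : ℕ, Integrable (fun p => Y p * b p ^ N * Real.exp (-(W * b p))) μ)
    (hid : ∀ w, W < w → ∫ p, (X p + Y p * w) * Real.exp (-(w * b p)) ∂μ = C * Real.exp (-w))
    (m : ℝ) : ∫ p, (X p + Y p * (W - m / b p)) * (b p ^ m * Real.exp (-(W * b p))) ∂μ =
      C * Real.exp (-W) := by
  obtain ⟨k, hk⟩ := exists_nat_gt m
  set a : ℝ := k - m with ha
  have ha0 : 0 < a := sub_pos.2 hk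
  have hΓ : 0 < Real.Gamma a := Real.Gamma_pos_of_pos ha0
  have hnat := integral_pow_mul_exp_of_exp hb hbm hXm hYm hW hX hY hid k
  set H : Ω → ℝ → ℝ := fun p t => t ^ (a - 1) * ((X p * b p ^ k +
    Y p * ((W + t) * b p ^ k - k * b p ^ (k - 1))) * Real.exp (-((W + t) * b p))) with hH
  have hγ : ∀ c : ℝ, 0 < c → ∀ r : ℝ, 0 < r → IntegrableOn
      (fun t : ℝ => t ^ (c - 1) * Real.exp (-(r * t))) (Set.Ioi 0) := by
    intro c hc r hr
    have := integrableOn_rpow_mul_exp_neg_mul_rpow (s := c - 1) (p := 1) (b := r) (by linarith)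
      one_pos hr
    simpa using this
  have hγ1 := hγ a ha0
  have hγ2 : ∀ r : ℝ, 0 < r → IntegrableOn
      (fun t : ℝ => t ^ (a - 1) * t * Real.exp (-(r * t))) (Set.Ioi 0) := by
    intro r hr
    refine (hγ (a + 1) (by linarith) r hr).congr_fun (fun t ht => ?_) measurableSet_Ioi
    have ht' : (0:ℝ) < t := ht
    simp only
    rw [← Real.rpow_add_one ht'.ne']
    ring_nf
  have hint1 : ∀ r : ℝ, 0 < r → ∫ t in Set.Ioi (0:ℝ), t ^ (a - 1) * Real.exp (-(r * t)) =
      (1 / r) ^ a * Real.Gamma a := fun r hr => Real.integral_rpow_mul_exp_neg_mul_Ioi ha0 hr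
  have hint2 : ∀ r : ℝ, 0 < r → ∫ t in Set.Ioi (0:ℝ), t ^ (a - 1) * t * Real.exp (-(r * t)) =
      (1 / r) ^ (a + 1) * (a * Real.Gamma a) := by
    intro r hr
    rw [← Real.Gamma_add_one ha0.ne', ← Real.integral_rpow_mul_exp_neg_mul_Ioi (by linarith) hr]
    refine setIntegral_congr_fun measurableSet_Ioi fun t ht => ?_
    have ht' : (0:ℝ) < t := ht
    rw [← Real.rpow_add_one ht'.ne']
    ring_nf
  have hHint : Integrable (Function.uncurry H) (μ.prod (volume.restrict (Set.Ioi 0))) := by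
    have i1 : Integrable (fun z : Ω × ℝ => (‖X z.1 * b z.1 ^ k * Real.exp (-(W * b z.1))‖ +
        (W + k) * ‖Y z.1 * b z.1 ^ k * Real.exp (-(W * b z.1))‖) *
        (z.2 ^ (a - 1) * Real.exp (-(1 * z.2)))) (μ.prod (volume.restrict (Set.Ioi 0))) :=
      Integrable.mul_prod (f := fun p => ‖X p * b p ^ k * Real.exp (-(W * b p))‖ +
        (W + k) * ‖Y p * b p ^ k * Real.exp (-(W * b p))‖)
        ((hX k).norm.add ((hY k).norm.const_mul _)) (hγ1 1 one_pos)
    have i2 : Integrable (fun z : Ω × ℝ => ‖Y z.1 * b z.1 ^ k * Real.exp (-(W * b z.1))‖ *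
        (z.2 ^ (a - 1) * z.2 * Real.exp (-(1 * z.2)))) (μ.prod (volume.restrict (Set.Ioi 0))) :=
      Integrable.mul_prod (f := fun p => ‖Y p * b p ^ k * Real.exp (-(W * b p))‖)
        (hY k).norm (hγ2 1 one_pos)
    refine (i1.add i2).mono' ?_ ?_
    · apply Measurable.aestronglyMeasurable
      simp only [hH]
      fun_prop
    · have hae : ∀ᵐ z ∂(μ.prod (volume.restrict (Set.Ioi (0:ℝ)))), 0 < z.2 := by
        have : ∀ᵐ t ∂(volume.restrict (Set.Ioi (0:ℝ))), 0 < t :=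
          ae_restrict_mem measurableSet_Ioi
        exact Measure.quasiMeasurePreserving_snd.ae this
      filter_upwards [hae] with z ht
      obtain ⟨p, t⟩ := z
      simp only at ht
      have hb0 : 0 < b p := zero_lt_one.trans_le (hb p)
      have he : Real.exp (-((W + t) * b p)) ≤ Real.exp (-(W * b p)) * Real.exp (-(1 * t)) := by
        rw [← Real.exp_add]
        apply Real.exp_le_exp.2
        nlinarith [mul_le_mul_of_nonneg_left (hb p) ht.le]
      have h1 : |(W + t) * b p ^ k - k * b p ^ (k - 1)| ≤ (W + t + k) * b p ^ k := by
        have h2 : b p ^ (k - 1) ≤ b p ^ k := pow_le_pow_right₀ (hb p) (Nat.sub_le _ _)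
        have h3 : (0:ℝ) ≤ k * b p ^ (k - 1) := by positivity
        have h4 : (k:ℝ) * b p ^ (k - 1) ≤ k * b p ^ k := by gcongr
        have h6 : 0 ≤ (W + t) * b p ^ k := by positivity
        rw [abs_le]; constructor <;> nlinarith
      have ht1 : 0 ≤ t ^ (a - 1) := Real.rpow_nonneg ht.le _
      simp only [hH, Function.uncurry, Real.norm_eq_abs, Pi.add_apply]
      simp only [abs_mul, Real.abs_exp, abs_of_pos (pow_pos hb0 k), abs_of_nonneg ht1]
      calc t ^ (a - 1) * (|X p * b p ^ k + Y p * ((W + t) * b p ^ k - k * b p ^ (k - 1))| *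
            Real.exp (-((W + t) * b p)))
          ≤ t ^ (a - 1) * ((|X p| * b p ^ k + |Y p| * ((W + t + k) * b p ^ k)) *
            (Real.exp (-(W * b p)) * Real.exp (-(1 * t)))) := by
            gcongr
            refine (abs_add_le _ _).trans ?_
            rw [abs_mul, abs_mul, abs_of_pos (pow_pos hb0 k)]
            gcongr
        _ = _ := by ring
  have hswap := integral_integral_swap hHint
  -- The inner integral in `t` gives `b ^ m e^{-W b}`, the one in `p` is known for each `t`.
  have hL : ∀ p, ∫ t in Set.Ioi (0:ℝ), H p t =
      Real.Gamma a * ((X p + Y p * (W - m / b p)) * (b p ^ m * Real.exp (-(W * b p)))) := by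
    intro p
    have hb0 : 0 < b p := zero_lt_one.trans_le (hb p)
    have e1 : ∀ t, H p t = ((X p * b p ^ k + Y p * (W * b p ^ k - k * b p ^ (k - 1))) *
        Real.exp (-(W * b p))) * (t ^ (a - 1) * Real.exp (-(b p * t))) +
        (Y p * b p ^ k * Real.exp (-(W * b p))) * (t ^ (a - 1) * t * Real.exp (-(b p * t))) := by
      intro t
      simp only [hH]
      rw [show -((W + t) * b p) = -(W * b p) + -(b p * t) by ring, Real.exp_add]
      ring
    simp only [e1]
    rw [integral_add ((hγ1 _ hb0).const_mul _) ((hγ2 _ hb0).const_mul _), integral_const_mul,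
      integral_const_mul, hint1 _ hb0, hint2 _ hb0]
    have e2 : (1 / b p) ^ a * b p ^ k = b p ^ m := by
      rw [one_div, Real.inv_rpow hb0.le, ← Real.rpow_neg hb0.le, ← Real.rpow_natCast,
        ← Real.rpow_add hb0]
      congr 1; rw [ha]; ring
    have e3 : (1 / b p) ^ (a + 1) * b p = (1 / b p) ^ a := by
      rw [Real.rpow_add_one (by positivity)]
      field_simp
    have e4 : (k:ℝ) * b p ^ (k - 1) * b p = k * b p ^ k := by
      cases k with
      | zero => simp
      | succ n => rw [Nat.add_sub_cancel, pow_succ]; ring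
    have e5 : (1 / b p) ^ (a + 1) = (1 / b p) ^ a / b p := by rw [← e3]; field_simp
    have e6 : (k:ℝ) * b p ^ (k - 1) = k * b p ^ k / b p := by rw [← e4]; field_simp
    rw [e5, e6, ← e2, show m = k - a by rw [ha]; ring]
    field_simp
    ring
  have hR : ∀ t ∈ Set.Ioi (0:ℝ), ∫ p, H p t ∂μ =
      C * Real.exp (-W) * (t ^ (a - 1) * Real.exp (-(1 * t))) := by
    intro t ht
    have ht' : (0:ℝ) < t := ht
    simp only [hH]
    rw [integral_const_mul, hnat (W + t) (by linarith), neg_add, Real.exp_add, one_mul]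
    ring
  rw [setIntegral_congr_fun measurableSet_Ioi hR, integral_const_mul, hint1 1 one_pos] at hswap
  simp only [hL] at hswap
  rw [integral_const_mul, div_one, Real.one_rpow, one_mul] at hswap
  exact mul_left_cancel₀ hΓ.ne' (by rw [hswap]; ring)

end

end

/-! ### Two explicit integrals -/

section

theorem lintegral_exp_neg_sq_half :
    ∫⁻ x : ℝ, ENNReal.ofReal (Real.exp (-(1 / 2) * x ^ 2)) = ENNReal.ofReal √(2 * Real.pi) := by
  rw [← ofReal_integral_eq_lintegral_ofReal (integrable_exp_neg_mul_sq (by norm_num))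
    (Filter.Eventually.of_forall fun x => (Real.exp_pos _).le), integral_gaussian]
  congr 2
  ring

open scoped MatrixOrder Matrix.Norms.L2Operator in
/-- The Gaussian integral of a positive definite quadratic form. -/
theorem lintegral_exp_neg_quadratic {n : Type*} [Fintype n] [DecidableEq n] {A : Matrix n n ℝ}
    (hA : A.PosDef) : ∫⁻ s : n → ℝ, ENNReal.ofReal (Real.exp (-(1 / 2) * (s ⬝ᵥ A.mulVec s))) =
      ENNReal.ofReal (√(2 * Real.pi) ^ Fintype.card n / √A.det) := by
  obtain ⟨R, hR⟩ : ∃ R : Matrix n n ℝ, A = R.transpose * R := by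
    obtain ⟨R, hR⟩ := CStarAlgebra.nonneg_iff_eq_star_mul_self.1
      (Matrix.nonneg_iff_posSemidef.2 hA.posSemidef)
    refine ⟨R, hR.trans ?_⟩
    rw [Matrix.star_eq_conjTranspose, Matrix.conjTranspose_eq_transpose_of_trivial]
  have hdet : A.det = R.det ^ 2 := by rw [hR, Matrix.det_mul, Matrix.det_transpose, sq]
  have hR0 : R.det ≠ 0 := by
    intro h
    have := hA.det_pos
    rw [hdet, h] at this
    norm_num at this
  set g : (n → ℝ) → ENNReal := fun x => ENNReal.ofReal (Real.exp (-(1 / 2) * (x ⬝ᵥ x))) with hg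
  have hgm : Measurable g := by
    simp only [hg, dotProduct]
    fun_prop
  have h1 : ∀ s : n → ℝ, ENNReal.ofReal (Real.exp (-(1 / 2) * (s ⬝ᵥ A.mulVec s))) =
      g (Matrix.toLin' R s) := by
    intro s
    simp only [hg, Matrix.toLin'_apply, hR]
    rw [← Matrix.mulVec_mulVec, Matrix.dotProduct_mulVec, Matrix.vecMul_transpose]
  have h2 : ∫⁻ x, g x = ENNReal.ofReal (√(2 * Real.pi) ^ Fintype.card n) := by
    have e1 : ∀ x, g x = ENNReal.ofReal (∏ i, Real.exp (-(1 / 2) * x i ^ 2)) := by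
      intro x
      simp only [hg, ← Real.exp_sum, dotProduct, ← Finset.mul_sum, sq]
    simp only [e1]
    have hi : Integrable fun x : n → ℝ => ∏ i, Real.exp (-(1 / 2) * x i ^ 2) :=
      Integrable.fintype_prod fun _ => integrable_exp_neg_mul_sq (by norm_num)
    rw [← ofReal_integral_eq_lintegral_ofReal hi
      (Filter.Eventually.of_forall fun x => Finset.prod_nonneg fun i _ => (Real.exp_pos _).le),
      integral_fintype_prod_volume_eq_pow (fun x : ℝ => Real.exp (-(1 / 2) * x ^ 2)),
      integral_gaussian]
    congr 3
    ring
  simp only [h1]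
  rw [← lintegral_map hgm (by
      rw [Matrix.toLin'_apply']
      exact (Matrix.mulVecLin R).continuous_of_finiteDimensional.measurable),
    Real.map_matrix_volume_pi_eq_smul_volume_pi hR0, lintegral_smul_measure, h2, smul_eq_mul,
    ← ENNReal.ofReal_mul (abs_nonneg _)]
  congr 1
  rw [hdet, Real.sqrt_sq_eq_abs, abs_inv]
  field_simp

theorem image_sqrt_sub_div_sqrt {c : ℝ} (hc : 0 < c) :
    (fun y : ℝ => √y - c / √y) '' Set.Ioi 0 = Set.univ := by
  rw [Set.eq_univ_iff_forall]
  intro x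
  have h1 : 0 ≤ x ^ 2 + 4 * c := by positivity
  have h2 : |x| < √(x ^ 2 + 4 * c) := by
    rw [← Real.sqrt_sq_eq_abs]
    exact Real.sqrt_lt_sqrt (sq_nonneg _) (by linarith)
  have h3 : 0 < (x + √(x ^ 2 + 4 * c)) / 2 := by
    have := neg_abs_le x
    linarith
  refine ⟨((x + √(x ^ 2 + 4 * c)) / 2) ^ 2, by simpa using pow_pos h3 2, ?_⟩
  simp only
  rw [Real.sqrt_sq h3.le]
  have h4 := Real.sq_sqrt h1
  rw [sub_eq_iff_eq_add, ← sub_eq_iff_eq_add', eq_div_iff h3.ne']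
  nlinarith

theorem injOn_sqrt_sub_div_sqrt {c : ℝ} (hc : 0 < c) :
    Set.InjOn (fun y : ℝ => √y - c / √y) (Set.Ioi 0) := by
  refine StrictMonoOn.injOn fun a ha b hb hab => ?_
  have ha' : 0 < √a := Real.sqrt_pos.2 ha
  have h1 : √a < √b := Real.sqrt_lt_sqrt (le_of_lt ha) hab
  exact sub_lt_sub h1 (div_lt_div_of_pos_left hc ha' h1)

/-- The total mass of the (reciprocal) inverse Gaussian law, by the substitution
`x = √y - c / √y` and the symmetry `y ↦ c² / y`. -/
theorem lintegral_inverse_gaussian {c : ℝ} (hc : 0 < c) :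
    ∫⁻ y in Set.Ioi (0 : ℝ), ENNReal.ofReal (Real.exp (-(1 / 2) * (y + c ^ 2 / y)) / √y) =
      ENNReal.ofReal (√(2 * Real.pi) * Real.exp (-c)) := by
  set φ : ℝ → ℝ := fun y => Real.exp (-(1 / 2) * (y + c ^ 2 / y)) with hφ
  have hφ0 : ∀ y, 0 < φ y := fun y => Real.exp_pos _
  set I := ∫⁻ y in Set.Ioi (0 : ℝ), ENNReal.ofReal (φ y / √y) with hI
  have key1 : ENNReal.ofReal √(2 * Real.pi) = ∫⁻ y in Set.Ioi (0 : ℝ),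
      ENNReal.ofReal (Real.exp c / 2 * (φ y / √y + c / y * (φ y / √y))) := by
    rw [← lintegral_exp_neg_sq_half, ← setLIntegral_univ, ← image_sqrt_sub_div_sqrt hc,
      lintegral_image_eq_lintegral_abs_deriv_mul measurableSet_Ioi
        (f' := fun y => 1 / (2 * √y) * (1 + c / y)) ?_ (injOn_sqrt_sub_div_sqrt hc)]
    · refine setLIntegral_congr_fun measurableSet_Ioi fun y hy => ?_
      have hy' : (0:ℝ) < y := hy
      have hs : 0 < √y := Real.sqrt_pos.2 hy'
      have hsq : √y ^ 2 = y := Real.sq_sqrt hy'.le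
      rw [← ENNReal.ofReal_mul (abs_nonneg _), abs_of_pos (by positivity)]
      congr 1
      have : Real.exp (-(1 / 2) * (√y - c / √y) ^ 2) = Real.exp c * φ y := by
        rw [hφ, ← Real.exp_add]
        congr 1
        have : (√y - c / √y) ^ 2 = √y ^ 2 + c ^ 2 / √y ^ 2 - 2 * c := by field_simp; ring
        rw [this, hsq]; ring
      rw [this]
      field_simp
    · intro y hy
      have hy' : (0:ℝ) < y := hy
      have hs : 0 < √y := Real.sqrt_pos.2 hy'
      have hsq : √y ^ 2 = y := Real.sq_sqrt hy'.le
      have h1 := Real.hasDerivAt_sqrt hy'.ne'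
      have h2 := h1.sub ((hasDerivAt_const y c).div h1 hs.ne')
      refine (HasDerivAt.congr_deriv h2 ?_).hasDerivWithinAt
      rw [hsq]
      field_simp
      ring
  have key2 : I = ∫⁻ y in Set.Ioi (0 : ℝ), ENNReal.ofReal (c / y * (φ y / √y)) := by
    have himg : (fun t : ℝ => c ^ 2 / t) '' Set.Ioi 0 = Set.Ioi 0 := by
      ext x
      constructor
      · rintro ⟨t, ht, rfl⟩
        have ht' : (0:ℝ) < t := ht
        exact div_pos (by positivity) ht'
      · intro hx
        have hx' : (0:ℝ) < x := hx
        refine ⟨c ^ 2 / x, div_pos (by positivity) hx', ?_⟩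
        simp only
        field_simp
    rw [hI]
    conv_lhs => rw [← himg]
    rw [lintegral_image_eq_lintegral_abs_deriv_mul measurableSet_Ioi
      (f' := fun t => - (c ^ 2 / t ^ 2)) ?_ ?_]
    · refine setLIntegral_congr_fun measurableSet_Ioi fun y hy => ?_
      have hy' : (0:ℝ) < y := hy
      have hs : 0 < √y := Real.sqrt_pos.2 hy'
      have hsq : √y * √y = y := Real.mul_self_sqrt hy'.le
      rw [← ENNReal.ofReal_mul (abs_nonneg _), abs_neg, abs_of_pos (by positivity)]
      congr 1
      have e1 : φ (c ^ 2 / y) = φ y := by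
        simp only [hφ]
        congr 2
        field_simp
        ring
      have e2 : √(c ^ 2 / y) = c / √y := by
        rw [Real.sqrt_div (by positivity), Real.sqrt_sq hc.le]
      rw [e1, e2]
      field_simp
      rw [sq, hsq, mul_comm]
    · intro t ht
      have ht' : (0:ℝ) < t := ht
      have h2 := (hasDerivAt_const t (c ^ 2)).div (hasDerivAt_id t) ht'.ne'
      refine (HasDerivAt.congr_deriv h2 ?_).hasDerivWithinAt
      simp
      ring
    · intro a ha b hb hab
      have ha' : (0:ℝ) < a := ha
      have hb' : (0:ℝ) < b := hb
      simp only at hab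
      field_simp at hab
      exact hab.symm
  have hm1 : Measurable fun y => ENNReal.ofReal (φ y / √y) := by
    simp only [hφ]; fun_prop
  have key3 : ENNReal.ofReal √(2 * Real.pi) = ENNReal.ofReal (Real.exp c) * I := by
    have e1 : ∀ y ∈ Set.Ioi (0:ℝ),
        ENNReal.ofReal (Real.exp c / 2 * (φ y / √y + c / y * (φ y / √y))) =
        ENNReal.ofReal (Real.exp c / 2) * (ENNReal.ofReal (φ y / √y) +
          ENNReal.ofReal (c / y * (φ y / √y))) := by
      intro y hy
      have hy' : (0:ℝ) < y := hy
      have := hφ0 y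
      rw [ENNReal.ofReal_mul (by positivity), ENNReal.ofReal_add (by positivity) (by positivity)]
    rw [key1, setLIntegral_congr_fun measurableSet_Ioi e1, lintegral_const_mul' _ _ (by simp),
      lintegral_add_left hm1, ← key2, ← hI, ← two_mul, ← mul_assoc]
    congr 1
    rw [← ENNReal.ofReal_ofNat, ← ENNReal.ofReal_mul (by positivity)]
    congr 1
    ring
  rw [mul_comm, ENNReal.ofReal_mul (Real.exp_pos _).le, key3, ← mul_assoc,
    ← ENNReal.ofReal_mul (Real.exp_pos _).le, ← Real.exp_add]
  simp

end

/-! ### The random Schrödinger operator integral -/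

section

section MMatrix
variable {n : Type*} [Fintype n] [DecidableEq n]

/-- A positive definite matrix with nonpositive off-diagonal entries has a nonnegative inverse. -/
theorem nonneg_of_mulVec_nonneg {H : Matrix n n ℝ} (hH : H.PosDef) (hoff : ∀ i j, i ≠ j → H i j ≤ 0)
    {x : n → ℝ} (hx : ∀ i, 0 ≤ H.mulVec x i) (i : n) : 0 ≤ x i := by
  -- Test the equation against the negative part of `x`.
  set z : n → ℝ := fun i => max (-x i) 0 with hz
  have hz0 : ∀ i, 0 ≤ z i := fun i => le_max_right _ _
  by_contra hi
  have hzne : z ≠ 0 := by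
    intro h
    have := congrFun h i
    simp only [hz, Pi.zero_apply] at this
    have h2 := le_max_left (-x i) 0
    linarith
  have h1 := hH.dotProduct_mulVec_pos hzne
  rw [star_trivial] at h1
  have h2 : 0 ≤ z ⬝ᵥ H.mulVec x := Finset.sum_nonneg fun i _ => mul_nonneg (hz0 i) (hx i)
  have h3 : z ⬝ᵥ H.mulVec (x + z) ≤ 0 := by
    refine Finset.sum_nonpos fun i _ => ?_
    simp only [Matrix.mulVec, dotProduct, Finset.mul_sum]
    refine Finset.sum_nonpos fun j _ => ?_
    have hxz : 0 ≤ x j + z j := by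
      have := le_max_left (-x j) 0
      simp only [hz]; linarith
    by_cases hij : i = j
    · subst hij
      have : z i * (x i + z i) = 0 := by
        simp only [hz]
        rcases le_total (-x i) 0 with h | h
        · rw [max_eq_right h]; ring
        · rw [max_eq_left h]; ring
      have h4 : z i * (H i i * (x + z) i) = H i i * (z i * (x i + z i)) := by
        simp only [Pi.add_apply]; ring
      rw [h4, this, mul_zero]
    · exact mul_nonpos_of_nonneg_of_nonpos (hz0 i)
        (mul_nonpos_of_nonpos_of_nonneg (hoff i j hij) hxz)
  rw [Matrix.mulVec_add, dotProduct_add] at h3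
  linarith

theorem pos_of_mulVec_pos {H : Matrix n n ℝ} (hH : H.PosDef) (hoff : ∀ i j, i ≠ j → H i j ≤ 0)
    {x : n → ℝ} (hx : ∀ i, 0 < H.mulVec x i) (i : n) : 0 < x i := by
  have h0 := nonneg_of_mulVec_nonneg hH hoff fun i => (hx i).le
  refine lt_of_le_of_ne (h0 i) fun h => ?_
  have h1 := hx i
  have h2 : H.mulVec x i ≤ 0 := by
    refine Finset.sum_nonpos fun j _ => ?_
    by_cases hij : i = j
    · subst hij
      rw [← h, mul_zero]
    · exact mul_nonpos_of_nonpos_of_nonneg (hoff i j hij) (h0 j)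
  linarith

end MMatrix

open Classical in
/-- The density, on the set of `γ` for which `H = diag γ - w` is positive definite, of the random
Schrödinger operator `H` with potential `γ` and boundary field `h`. -/
def schrDensity {n : Type*} [Fintype n] [DecidableEq n] (w : Matrix n n ℝ) (h γ : n → ℝ) :
    ENNReal :=
  if (Matrix.diagonal γ - w).PosDef then
    ENNReal.ofReal (Real.exp (-(1 / 2) * (1 ⬝ᵥ (Matrix.diagonal γ - w).mulVec 1) -
      1 / 2 * (h ⬝ᵥ (Matrix.diagonal γ - w)⁻¹.mulVec h) + ∑ i, h i) /
      √(Matrix.diagonal γ - w).det)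
  else 0

section
variable {n : Type*} [Fintype n] [DecidableEq n]

theorem measurableSet_posDef (w : Matrix n n ℝ) :
    MeasurableSet {γ : n → ℝ | (Matrix.diagonal γ - w).PosDef} := by
  have hc : Continuous fun γ : n → ℝ => Matrix.diagonal γ - w := by fun_prop
  by_cases hw : w.IsHermitian
  · have hH : ∀ γ : n → ℝ, (Matrix.diagonal γ - w).IsHermitian := fun γ =>
      (Matrix.isHermitian_diagonal γ).sub hw
    have h1 : {γ : n → ℝ | (Matrix.diagonal γ - w).PosDef} =
        {γ : n → ℝ | ∀ x : n → ℝ, 0 ≤ x ⬝ᵥ (Matrix.diagonal γ - w).mulVec x} ∩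
        {γ : n → ℝ | (Matrix.diagonal γ - w).det ≠ 0} := by
      ext γ
      constructor
      · exact fun h => ⟨fun x => by simpa using h.posSemidef.dotProduct_mulVec_nonneg x,
          h.det_pos.ne'⟩
      · rintro ⟨h1, h2⟩
        have h3 : (Matrix.diagonal γ - w).PosSemidef :=
          Matrix.PosSemidef.of_dotProduct_mulVec_nonneg (hH γ) fun x => by simpa using h1 x
        exact h3.posDef_iff_det_ne_zero.2 h2
    rw [h1]
    refine MeasurableSet.inter (IsClosed.measurableSet ?_) (IsOpen.measurableSet ?_)
    · simp only [Set.ofPred_forall]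
      refine isClosed_iInter fun x => isClosed_le continuous_const ?_
      fun_prop
    · exact isOpen_ne_fun hc.matrix_det continuous_const
  · have : {γ : n → ℝ | (Matrix.diagonal γ - w).PosDef} = ∅ := by
      rw [Set.eq_empty_iff_forall_notMem]
      intro γ h
      apply hw
      have := (Matrix.isHermitian_diagonal γ).sub h.isHermitian
      simpa using this
    rw [this]
    exact MeasurableSet.empty

theorem measurable_schrDensity (w : Matrix n n ℝ) (h : n → ℝ) : Measurable (schrDensity w h) := by
  classical
  have hc : Continuous fun γ : n → ℝ => Matrix.diagonal γ - w := by fun_prop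
  refine Measurable.ite (measurableSet_posDef w) ?_ measurable_const
  have h1 : Measurable fun γ : n → ℝ => h ⬝ᵥ (Matrix.diagonal γ - w)⁻¹.mulVec h := by
    simp only [Matrix.inv_def, Ring.inverse_eq_inv', Matrix.smul_mulVec, dotProduct_smul]
    refine Measurable.mul hc.matrix_det.measurable.inv (Continuous.measurable ?_)
    exact continuous_const.dotProduct (hc.matrix_adjugate.matrix_mulVec continuous_const)
  have h2 : Measurable fun γ : n → ℝ => (1 : n → ℝ) ⬝ᵥ (Matrix.diagonal γ - w).mulVec 1 :=
    (continuous_const.dotProduct (hc.matrix_mulVec continuous_const)).measurable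
  have h3 : Measurable fun γ : n → ℝ => (Matrix.diagonal γ - w).det := hc.matrix_det.measurable
  fun_prop

theorem schrDensity_submatrix {k : Type*} [Fintype k] [DecidableEq k] (e : k ≃ n)
    (w : Matrix n n ℝ) (h γ : n → ℝ) :
    schrDensity (w.submatrix e e) (h ∘ e) (γ ∘ e) = schrDensity w h γ := by
  have h0 : Matrix.diagonal (γ ∘ e) - w.submatrix e e =
      (Matrix.diagonal γ - w).submatrix e e := by
    ext i j
    simp [Matrix.diagonal_apply]
  have h1 : ((Matrix.diagonal γ - w).submatrix e e).PosDef ↔ (Matrix.diagonal γ - w).PosDef := by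
    constructor
    · intro h
      have := h.submatrix e.symm.injective
      simpa using this
    · exact fun h => h.submatrix e.injective
  have h2 : ∀ (A : Matrix n n ℝ) (x : n → ℝ),
      (x ∘ e) ⬝ᵥ (A.submatrix e e).mulVec (x ∘ e) = x ⬝ᵥ A.mulVec x := by
    intro A x
    rw [Matrix.submatrix_mulVec_equiv]
    simp only [Function.comp_assoc, Equiv.self_comp_symm, Function.comp_id]
    rw [comp_equiv_dotProduct_comp_equiv]
  have h3 : ((1 : k → ℝ)) = (1 : n → ℝ) ∘ e := rfl
  unfold schrDensity
  rw [h0, h1, h3, h2, Matrix.inv_submatrix_equiv, h2, Matrix.det_submatrix_equiv_self]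
  simp only [Function.comp_apply, Equiv.sum_comp e h]

theorem lintegral_schrDensity_submatrix {k : Type*} [Fintype k] [DecidableEq k] (e : k ≃ n)
    (w : Matrix n n ℝ) (h : n → ℝ) :
    ∫⁻ γ, schrDensity w h γ = ∫⁻ γ, schrDensity (w.submatrix e e) (h ∘ e) γ := by
  have hmp := volume_measurePreserving_piCongrLeft (fun _ : n => ℝ) e
  rw [← hmp.lintegral_comp_emb (MeasurableEquiv.measurableEmbedding _)]
  refine lintegral_congr fun γ => ?_
  rw [← schrDensity_submatrix e]
  congr 1
  ext i
  simp only [Function.comp_apply]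
  exact MeasurableEquiv.piCongrLeft_apply_apply (β := fun _ => ℝ) e γ i

/-- The Schur complement computation: integrating out the potential at one vertex turns its
couplings `v` to the other vertices into an additional boundary field. -/
theorem lintegral_schrDensity_fiber {w : Matrix n n ℝ}
    (hw : ∀ i j, 0 ≤ w i j) {v : n → ℝ} (hv : ∀ i, 0 ≤ v i) (w0 : ℝ) {h : n → ℝ}
    (hh : ∀ i, 0 < h i) {h0 : ℝ} (hh0 : 0 < h0) (γ : n → ℝ) :
    ∫⁻ g : ℝ, schrDensity (Matrix.fromBlocks w (Matrix.replicateCol Unit v)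
      (Matrix.replicateRow Unit v) (Matrix.diagonal fun _ => w0)) (Sum.elim h fun _ => h0)
      (Sum.elim γ fun _ => g) =
    ENNReal.ofReal √(2 * Real.pi) * schrDensity w (h + v) γ := by
  classical
  set A := Matrix.diagonal γ - w with hAdef
  have hblock : ∀ g : ℝ, Matrix.diagonal (Sum.elim γ fun _ : Unit => g) -
      Matrix.fromBlocks w (Matrix.replicateCol Unit v) (Matrix.replicateRow Unit v)
        (Matrix.diagonal fun _ => w0) =
      Matrix.fromBlocks A (-Matrix.replicateCol Unit v) (-Matrix.replicateCol Unit v).conjTranspose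
        (Matrix.diagonal fun _ => g - w0) := by
    intro g
    ext i j
    rcases i with i | i <;> rcases j with j | j <;> simp [hAdef, Matrix.diagonal_apply]
  by_cases hA : A.PosDef
  swap
  · have h1 : ∀ g : ℝ, ¬ (Matrix.diagonal (Sum.elim γ fun _ : Unit => g) -
      Matrix.fromBlocks w (Matrix.replicateCol Unit v) (Matrix.replicateRow Unit v)
        (Matrix.diagonal fun _ => w0)).PosDef := by
      intro g hP
      rw [hblock] at hP
      exact hA (hP.submatrix Sum.inl_injective)
    simp only [schrDensity, if_neg (h1 _), ← hAdef, if_neg hA]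
    simp
  have hAu : IsUnit A.det := hA.det_pos.ne'.isUnit
  let _ : Invertible A := A.invertibleOfIsUnitDet hAu
  have hsymm : ∀ x y : n → ℝ, x ⬝ᵥ A⁻¹.mulVec y = y ⬝ᵥ A⁻¹.mulVec x := by
    intro x y
    rw [Matrix.dotProduct_mulVec, ← Matrix.mulVec_transpose, dotProduct_comm]
    congr 2
    have := hA.inv.isHermitian
    rwa [Matrix.IsHermitian, Matrix.conjTranspose_eq_transpose_of_trivial] at this
  set q := v ⬝ᵥ A⁻¹.mulVec v with hq
  set c := h0 + v ⬝ᵥ A⁻¹.mulVec h with hc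
  have hoff : ∀ i j, i ≠ j → A i j ≤ 0 := by
    intro i j hij
    simp [hAdef, hij, hw]
  have hc0 : 0 < c := by
    have h1 : ∀ i, 0 ≤ A⁻¹.mulVec h i := by
      refine nonneg_of_mulVec_nonneg hA hoff fun i => ?_
      rw [Matrix.mulVec_mulVec, Matrix.mul_nonsing_inv _ hAu, Matrix.one_mulVec]
      exact (hh i).le
    have : 0 ≤ v ⬝ᵥ A⁻¹.mulVec h := Finset.sum_nonneg fun i _ => mul_nonneg (hv i) (h1 i)
    linarith
  -- The Schur complement is the scalar `g - w0 - q`.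
  have hschur : ∀ g : ℝ, ((Matrix.diagonal fun _ : Unit => g - w0) -
      (-Matrix.replicateCol Unit v).conjTranspose * A⁻¹ * (-Matrix.replicateCol Unit v)) =
      Matrix.diagonal fun _ => g - (w0 + q) := by
    intro g
    ext i j
    have e1 : ((-Matrix.replicateCol Unit v).conjTranspose * A⁻¹ *
        (-Matrix.replicateCol Unit v)) i j = q := by
      rw [Matrix.mul_assoc, Matrix.mul_neg, Matrix.conjTranspose_neg, Matrix.neg_mul,
        Matrix.mul_neg, neg_neg, ← Matrix.replicateCol_mulVec]
      rw [hq]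
      simp [Matrix.mul_apply, dotProduct]
    rw [Matrix.sub_apply, e1]
    simp
    ring
  have hdet : ∀ g : ℝ, (Matrix.fromBlocks A (-Matrix.replicateCol Unit v)
      (-Matrix.replicateCol Unit v).conjTranspose (Matrix.diagonal fun _ => g - w0)).det =
      A.det * (g - (w0 + q)) := by
    intro g
    rw [Matrix.det_fromBlocks₁₁, Matrix.invOf_eq_nonsing_inv, hschur]
    simp
  have hpos : ∀ g : ℝ, (Matrix.fromBlocks A (-Matrix.replicateCol Unit v)
      (-Matrix.replicateCol Unit v).conjTranspose (Matrix.diagonal fun _ => g - w0)).PosDef ↔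
      0 < g - (w0 + q) := by
    intro g
    have e1 := Matrix.PosDef.fromBlocks₁₁ (-Matrix.replicateCol Unit v)
      (Matrix.diagonal fun _ : Unit => g - w0) hA
    rw [hschur, Matrix.posSemidef_diagonal_iff] at e1
    constructor
    · intro hP
      have h1 := e1.1 hP.posSemidef ()
      have h2 := hP.det_pos
      rw [hdet] at h2
      exact pos_of_mul_pos_right h2 hA.det_pos.le
    · intro hy
      have h1 := e1.2 fun _ => hy.le
      refine h1.posDef_iff_det_ne_zero.2 ?_
      rw [hdet]
      exact (mul_pos hA.det_pos hy).ne'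
  have hone : ∀ g : ℝ, (1 : n ⊕ Unit → ℝ) ⬝ᵥ (Matrix.fromBlocks A (-Matrix.replicateCol Unit v)
      (-Matrix.replicateCol Unit v).conjTranspose (Matrix.diagonal fun _ => g - w0)).mulVec 1 =
      1 ⬝ᵥ A.mulVec 1 - 2 * ∑ i, v i + (g - w0) := by
    intro g
    have e1 : (1 : n ⊕ Unit → ℝ) = Sum.elim (1 : n → ℝ) (1 : Unit → ℝ) := by ext i; cases i <;> rfl
    rw [e1, Matrix.fromBlocks_mulVec, Sum.elim_comp_inl, Sum.elim_comp_inr, sumElim_dotProduct_sumElim]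
    simp [dotProduct, Matrix.mulVec, Finset.sum_add_distrib]
    ring
  have hquad : ∀ g : ℝ, 0 < g - (w0 + q) → (Sum.elim h fun _ => h0) ⬝ᵥ
      (Matrix.fromBlocks A (-Matrix.replicateCol Unit v)
      (-Matrix.replicateCol Unit v).conjTranspose (Matrix.diagonal fun _ => g - w0))⁻¹.mulVec
      (Sum.elim h fun _ => h0) = h ⬝ᵥ A⁻¹.mulVec h + c ^ 2 / (g - (w0 + q)) := by
    intro g hy
    set y := g - (w0 + q) with hydef
    -- The solution of `H x = (h, h0)`, by block elimination.
    set x : n ⊕ Unit → ℝ := Sum.elim (A⁻¹.mulVec (h + (c / y) • v)) (fun _ => c / y) with hx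
    have hAx : ∀ z : n → ℝ, A.mulVec (A⁻¹.mulVec z) = z := fun z => by
      rw [Matrix.mulVec_mulVec, Matrix.mul_nonsing_inv _ hAu, Matrix.one_mulVec]
    have hsolve : (Matrix.fromBlocks A (-Matrix.replicateCol Unit v)
        (-Matrix.replicateCol Unit v).conjTranspose (Matrix.diagonal fun _ => g - w0)).mulVec x =
        Sum.elim h fun _ => h0 := by
      rw [hx, Matrix.fromBlocks_mulVec, Sum.elim_comp_inl, Sum.elim_comp_inr, hAx]
      congr 1
      · ext i
        simp [Matrix.mulVec, dotProduct]
        ring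
      · ext i
        have e1 : ((-Matrix.replicateCol Unit v).conjTranspose.mulVec
            (A⁻¹.mulVec (h + (c / y) • v))) i = -(v ⬝ᵥ A⁻¹.mulVec h + c / y * q) := by
          have : ((-Matrix.replicateCol Unit v).conjTranspose.mulVec
            (A⁻¹.mulVec (h + (c / y) • v))) i = -(v ⬝ᵥ A⁻¹.mulVec (h + (c / y) • v)) := by
            simp [Matrix.mulVec, dotProduct]
          rw [this, Matrix.mulVec_add, Matrix.mulVec_smul, dotProduct_add, dotProduct_smul,
            smul_eq_mul]
        rw [Pi.add_apply, e1]
        have e2 : ((Matrix.diagonal fun _ : Unit => g - w0).mulVec fun _ => c / y) i =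
            (g - w0) * (c / y) := by simp [Matrix.mulVec_diagonal]
        rw [e2, show g - w0 = y + q by rw [hydef]; ring, hc]
        field_simp
        ring
    have hu : IsUnit (Matrix.fromBlocks A (-Matrix.replicateCol Unit v)
        (-Matrix.replicateCol Unit v).conjTranspose (Matrix.diagonal fun _ => g - w0)).det :=
      ((hpos g).2 hy).det_pos.ne'.isUnit
    have e3 : (Matrix.fromBlocks A (-Matrix.replicateCol Unit v)
        (-Matrix.replicateCol Unit v).conjTranspose (Matrix.diagonal fun _ => g - w0))⁻¹.mulVec
        (Sum.elim h fun _ => h0) = x := by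
      rw [← hsolve, Matrix.mulVec_mulVec, Matrix.nonsing_inv_mul _ hu, Matrix.one_mulVec]
    rw [e3, hx, sumElim_dotProduct_sumElim, Matrix.mulVec_add, Matrix.mulVec_smul,
      dotProduct_add, dotProduct_smul, hsymm h v]
    simp only [dotProduct, Finset.univ_unique, Finset.sum_singleton, smul_eq_mul]
    rw [show ∑ i, v i * A⁻¹.mulVec h i = c - h0 by rw [hc]; simp [dotProduct]]
    field_simp
    ring
  -- The part of the density that does not depend on `y = g - (w0 + q)`.
  set K := Real.exp (-(1 / 2) * (1 ⬝ᵥ A.mulVec 1) + ∑ i, v i - 1 / 2 * q -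
    1 / 2 * (h ⬝ᵥ A⁻¹.mulVec h) + (∑ i, h i + h0)) / √A.det with hK
  have hK0 : 0 ≤ K := by positivity
  have hint : ∀ g : ℝ, schrDensity (Matrix.fromBlocks w (Matrix.replicateCol Unit v)
      (Matrix.replicateRow Unit v) (Matrix.diagonal fun _ => w0)) (Sum.elim h fun _ => h0)
      (Sum.elim γ fun _ => g) = (Set.Ioi (0:ℝ)).indicator (fun y => ENNReal.ofReal K *
        ENNReal.ofReal (Real.exp (-(1 / 2) * (y + c ^ 2 / y)) / √y)) (g - (w0 + q)) := by
    intro g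
    rw [schrDensity, hblock]
    by_cases hy : 0 < g - (w0 + q)
    · rw [if_pos ((hpos g).2 hy), Set.indicator_of_mem (Set.mem_Ioi.2 hy), hone, hquad g hy, hdet,
        ← ENNReal.ofReal_mul hK0]
      congr 1
      rw [hK, div_mul_div_comm, ← Real.exp_add, Real.sqrt_mul hA.det_pos.le]
      congr 2
      simp only [Fintype.sum_sum_type, Sum.elim_inl, Sum.elim_inr, Finset.univ_unique,
        Finset.sum_singleton]
      ring
    · rw [if_neg (fun hP => hy ((hpos g).1 hP)), Set.indicator_of_notMem (s := Set.Ioi 0) hy]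
  simp only [hint]
  rw [lintegral_sub_right_eq_self (μ := volume) (fun y => (Set.Ioi (0:ℝ)).indicator
      (fun y => ENNReal.ofReal K *
        ENNReal.ofReal (Real.exp (-(1 / 2) * (y + c ^ 2 / y)) / √y)) y) (w0 + q),
    lintegral_indicator measurableSet_Ioi, lintegral_const_mul' _ _ (by simp),
    lintegral_inverse_gaussian hc0, schrDensity, ← hAdef, if_pos hA,
    ← ENNReal.ofReal_mul hK0, ← ENNReal.ofReal_mul (Real.sqrt_nonneg _)]
  congr 1
  rw [hK, div_mul_eq_mul_div, mul_comm (Real.exp _), mul_assoc, ← Real.exp_add, ← mul_div_assoc]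
  congr 3
  rw [Matrix.mulVec_add, dotProduct_add, add_dotProduct, add_dotProduct, hsymm h v, ← hq, hc]
  simp only [Pi.add_apply, Finset.sum_add_distrib]
  ring

theorem lintegral_schrDensity_sum {w : Matrix (n ⊕ Unit) (n ⊕ Unit) ℝ} (hws : w.IsHermitian)
    (hw : ∀ i j, 0 ≤ w i j) {h : n ⊕ Unit → ℝ} (hh : ∀ i, 0 < h i) :
    ∫⁻ γ, schrDensity w h γ = ENNReal.ofReal √(2 * Real.pi) *
      ∫⁻ γ, schrDensity (w.submatrix Sum.inl Sum.inl)
        ((fun i => h (Sum.inl i)) + fun i => w (Sum.inl i) (Sum.inr ())) γ := by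
  have hmp := (volume_measurePreserving_sumPiEquivProdPi fun _ : n ⊕ Unit => ℝ).symm
  have hmp2 : MeasurePreserving (Prod.map (id : (n → ℝ) → (n → ℝ))
      (MeasurableEquiv.funUnique Unit ℝ).symm) (volume.prod volume) (volume.prod volume) :=
    (MeasurePreserving.id _).prod (volume_preserving_funUnique Unit ℝ).symm
  have hm := measurable_schrDensity w h
  rw [← hmp.lintegral_comp hm, Measure.volume_eq_prod,
    ← hmp2.lintegral_comp (f := fun a => schrDensity w h
      ((MeasurableEquiv.sumPiEquivProdPi fun _ : n ⊕ Unit => ℝ).symm a))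
      (hm.comp (MeasurableEquiv.measurable _)),
    lintegral_prod (fun a => schrDensity w h
      ((MeasurableEquiv.sumPiEquivProdPi fun _ : n ⊕ Unit => ℝ).symm
        (Prod.map id (MeasurableEquiv.funUnique Unit ℝ).symm a)))
      (((hm.comp (MeasurableEquiv.measurable _)).comp hmp2.measurable).aemeasurable),
    ← lintegral_const_mul _ (measurable_schrDensity _ _)]
  refine lintegral_congr fun γ => ?_
  have hw' : w = Matrix.fromBlocks (w.submatrix Sum.inl Sum.inl)
      (Matrix.replicateCol Unit fun i => w (Sum.inl i) (Sum.inr ()))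
      (Matrix.replicateRow Unit fun i => w (Sum.inl i) (Sum.inr ()))
      (Matrix.diagonal fun _ => w (Sum.inr ()) (Sum.inr ())) := by
    ext i j
    rcases i with i | i <;> rcases j with j | j
    · rfl
    · rfl
    · simp only [Matrix.fromBlocks_apply₂₁, Matrix.replicateRow_apply]
      simpa using hws.apply (Sum.inl j) (Sum.inr i)
    · rfl
  have hh' : h = Sum.elim (fun i => h (Sum.inl i)) (fun _ => h (Sum.inr ())) := by
    ext i; rcases i with i | i <;> rfl
  rw [← lintegral_schrDensity_fiber (w := w.submatrix Sum.inl Sum.inl)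
    (v := fun i => w (Sum.inl i) (Sum.inr ())) (w0 := w (Sum.inr ()) (Sum.inr ()))
    (h := fun i => h (Sum.inl i)) (h0 := h (Sum.inr ()))
    (fun i j => hw _ _) (fun i => hw _ _) (fun i => hh _) (hh _)]
  refine lintegral_congr fun g => ?_
  rw [← hw', ← hh']
  congr 1

end

/-- The total mass of the random Schrödinger operator density, by eliminating one vertex at a
time. It depends neither on the couplings nor on the boundary field. -/
theorem lintegral_schrDensity {n : Type*} [Fintype n] [DecidableEq n] {w : Matrix n n ℝ}
    (hws : w.IsHermitian) (hw : ∀ i j, 0 ≤ w i j) {h : n → ℝ} (hh : ∀ i, 0 < h i) :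
    ∫⁻ γ, schrDensity w h γ = ENNReal.ofReal (√(2 * Real.pi) ^ Fintype.card n) := by
  have key : ∀ (k : ℕ) (w : Matrix (Fin k) (Fin k) ℝ), w.IsHermitian → (∀ i j, 0 ≤ w i j) →
      ∀ h : Fin k → ℝ, (∀ i, 0 < h i) →
      ∫⁻ γ, schrDensity w h γ = ENNReal.ofReal (√(2 * Real.pi) ^ k) := by
    intro k
    induction k with
    | zero =>
      intro w _ _ h _
      have : ∀ γ, schrDensity w h γ = 1 := by
        intro γ
        rw [schrDensity, if_pos]
        · simp
        · refine Matrix.PosDef.of_dotProduct_mulVec_pos (by ext i; exact i.elim0) fun x hx => ?_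
          exact absurd (Subsingleton.elim x 0) hx
      simp [this, volume_pi]
    | succ k ih =>
      intro w hws hw h hh
      have e : Fin k ⊕ Unit ≃ Fin (k + 1) :=
        (Equiv.sumCongr (Equiv.refl _) (Equiv.ofUnique Unit (Fin 1))).trans finSumFinEquiv
      rw [lintegral_schrDensity_submatrix e, lintegral_schrDensity_sum (hws.submatrix e)
        (fun i j => hw _ _) (h := h ∘ e) (fun i => hh _), ih _ ((hws.submatrix e).submatrix Sum.inl)
        (fun i j => hw _ _)
        ((fun i => (h ∘ e) (Sum.inl i)) + fun i => w.submatrix e e (Sum.inl i) (Sum.inr ()))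
        (fun i => add_pos_of_pos_of_nonneg (hh _) (hw _ _)),
        ← ENNReal.ofReal_mul (Real.sqrt_nonneg _), pow_succ']
  have e := (Fintype.equivFin n).symm
  rw [lintegral_schrDensity_submatrix e, key _ _ (hws.submatrix e) (fun i j => hw _ _) (h ∘ e)
    (fun i => hh _)]

end

/-! ### Normalization for positive weights -/

section
variable {Λ : Type*}

@[fun_prop]
theorem continuous_ext (i : Option Λ) : Continuous fun u : Λ → ℝ => ext u i := by
  cases i with
  | none => exact continuous_const
  | some k => exact continuous_apply k

theorem continuous_edgeB (o : Orientation Λ) (e : Edge Λ) :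
    Continuous fun p : (Λ → ℝ) × (Λ → ℝ) => edgeB p.1 p.2 e := by
  have h1 : ∀ i, Continuous fun p : (Λ → ℝ) × (Λ → ℝ) => ext p.1 i :=
    fun i => (continuous_ext i).comp continuous_fst
  have h2 : ∀ i, Continuous fun p : (Λ → ℝ) × (Λ → ℝ) => ext p.2 i :=
    fun i => (continuous_ext i).comp continuous_snd
  simp only [edgeB_eq o, B]
  exact (Real.continuous_cosh.comp ((h1 _).sub (h1 _))).add
    ((continuous_const.mul (((h2 _).sub (h2 _)).pow 2)).mul
      (Real.continuous_exp.comp ((h1 _).add (h1 _))))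

theorem continuous_expW (o : Orientation Λ) (e : Edge Λ) :
    Continuous fun u : Λ → ℝ => expW o u e :=
  Real.continuous_exp.comp ((continuous_ext _).add (continuous_ext _))

theorem continuous_lap [Fintype Λ] [DecidableEq Λ] {α : Type*} [TopologicalSpace α]
    (o : Orientation Λ) {c : α → Edge Λ → ℝ} (hc : ∀ e, Continuous fun a => c a e) :
    Continuous fun a => lap o (c a) := by
  refine continuous_matrix fun i j => ?_
  simp only [lap_apply]
  exact continuous_finsetSum _ fun e _ => (hc e).mul continuous_const

section
variable [Fintype Λ]

/-- The single-site factors `e^{-u_i} / 2π` of the reference measure. -/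
def siteWeight (u : Λ → ℝ) : ℝ := ∏ i : Λ, (Real.exp (- u i) / (2 * Real.pi))

theorem siteWeight_pos (u : Λ → ℝ) : 0 < siteWeight u :=
  Finset.prod_pos fun i _ => by positivity

theorem continuous_siteWeight : Continuous (siteWeight (Λ := Λ)) := by
  unfold siteWeight
  fun_prop

end

section
variable [DecidableEq Λ]

/-- The couplings between the vertices of `Λ`, as a matrix. -/
def coupling (W : Edge Λ → ℝ) : Matrix Λ Λ ℝ := Matrix.of fun i j => weight W (some i) (some j)

/-- The pinning strengths. -/
def pinning (W : Edge Λ → ℝ) (i : Λ) : ℝ := weight W (some i) none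

theorem coupling_self (W : Edge Λ → ℝ) (i : Λ) : coupling W i i = 0 := weight_self W _

theorem coupling_isHermitian (W : Edge Λ → ℝ) : (coupling W).IsHermitian := by
  ext i j
  exact weight_comm W _ _

theorem pinning_pos {W : Edge Λ → ℝ} (hW : ∀ e, 0 < W e) (i : Λ) : 0 < pinning W i :=
  weight_pos hW (by simp)

theorem coupling_nonneg {W : Edge Λ → ℝ} (hW : ∀ e, 0 ≤ W e) (i j : Λ) : 0 ≤ coupling W i j :=
  weight_nonneg hW _ _

theorem connected_of_pos {W : Edge Λ → ℝ} (hW : ∀ e, 0 < W e) : (graphPlus W).Connected := by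
  have : graphPlus W = ⊤ := by
    ext i j
    exact ⟨fun h => h.ne, fun h => weight_pos hW h⟩
  rw [this]
  exact SimpleGraph.connected_top

end

variable [Fintype Λ] [DecidableEq Λ]

/-- The potential `γ_i = ∑_k W_{ik} e^{u_k - u_i}` as a function of the field `u`. -/
def potential (W : Edge Λ → ℝ) (u : Λ → ℝ) (i : Λ) : ℝ :=
  ∑ j, coupling W i j * Real.exp (u j - u i) + pinning W i * Real.exp (- u i)

/-- The random Schrödinger operator `diag γ - W` attached to the field `u`. -/
def schr (W : Edge Λ → ℝ) (u : Λ → ℝ) : Matrix Λ Λ ℝ :=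
  Matrix.diagonal (potential W u) - coupling W

/-- The Laplacian is the Schrödinger operator conjugated by `e^u`. -/
theorem D_eq_diagonal_mul_schr_mul (W : Edge Λ → ℝ) (u : Λ → ℝ) :
    D W u = Matrix.diagonal (fun i => Real.exp (u i)) * schr W u *
      Matrix.diagonal (fun i => Real.exp (u i)) := by
  ext i j
  rw [Matrix.mul_diagonal, Matrix.diagonal_mul, schr, Matrix.sub_apply]
  by_cases hij : i = j
  · subst hij
    simp only [D, Matrix.of_apply, if_true, Matrix.diagonal_apply_eq, coupling_self, sub_zero,
      potential, Fintype.sum_option, ext, Option.elim, add_zero]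
    rw [mul_add, add_mul, Finset.mul_sum, Finset.sum_mul, add_comm]
    congr 1
    · refine Finset.sum_congr rfl fun j _ => ?_
      rw [Real.exp_add, Real.exp_sub]
      have := Real.exp_ne_zero (u i)
      field_simp
      rfl
    · have := Real.exp_ne_zero (u i)
      rw [Real.exp_neg]
      field_simp
      rfl
  · rw [Matrix.diagonal_apply_ne _ hij]
    simp only [D, Matrix.of_apply, if_neg hij, ext, Option.elim, coupling, Real.exp_add]
    ring

theorem det_D_eq (W : Edge Λ → ℝ) (u : Λ → ℝ) :
    (D W u).det = (∏ i, Real.exp (u i)) ^ 2 * (schr W u).det := by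
  rw [D_eq_diagonal_mul_schr_mul, Matrix.det_mul, Matrix.det_mul, Matrix.det_diagonal]
  ring

theorem schr_posDef {W : Edge Λ → ℝ} (hW : ∀ e, 0 ≤ W e) (hconn : (graphPlus W).Connected)
    (o : Orientation Λ) (u : Λ → ℝ) : (schr W u).PosDef := by
  have hD : (D W u).PosDef := by
    rw [D_eq_lap o]
    exact lap_posDef o hconn (fun e => mul_nonneg (hW e) (expW_pos o u e).le)
      fun e he => mul_pos he (expW_pos o u e)
  have hU : IsUnit (Matrix.diagonal (fun i => Real.exp (u i))) := by
    rw [Matrix.isUnit_diagonal, Pi.isUnit_iff]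
    exact fun i => (Real.exp_ne_zero _).isUnit
  rw [← Matrix.IsUnit.posDef_star_left_conjugate_iff hU]
  rw [Matrix.star_eq_conjTranspose, Matrix.diagonal_conjTranspose, star_trivial,
    ← D_eq_diagonal_mul_schr_mul]
  exact hD

theorem schr_mulVec_exp (W : Edge Λ → ℝ) (u : Λ → ℝ) :
    (schr W u).mulVec (fun i => Real.exp (u i)) = pinning W := by
  ext i
  rw [schr, Matrix.sub_mulVec, Pi.sub_apply, Matrix.mulVec_diagonal, potential, add_mul,
    Finset.sum_mul, mul_assoc (pinning W i), ← Real.exp_add]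
  simp only [mul_assoc, ← Real.exp_add, sub_add_cancel, neg_add_cancel, Real.exp_zero, mul_one]
  simp [Matrix.mulVec, dotProduct]

theorem schr_inv_mulVec_pinning {W : Edge Λ → ℝ} (u : Λ → ℝ) (hH : (schr W u).PosDef) :
    (schr W u)⁻¹.mulVec (pinning W) = fun i => Real.exp (u i) := by
  rw [← schr_mulVec_exp W u, Matrix.mulVec_mulVec,
    Matrix.nonsing_inv_mul _ hH.det_pos.ne'.isUnit, Matrix.one_mulVec]

/-- The derivative of the potential with respect to the field. -/
theorem hasFDerivAt_potential (W : Edge Λ → ℝ) (u : Λ → ℝ) :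
    HasFDerivAt (potential W) (LinearMap.toContinuousLinearMap (Matrix.toLin'
      (-(Matrix.diagonal (fun i => Real.exp (- u i)) * schr W u *
        Matrix.diagonal (fun i => Real.exp (u i)))))) u := by
  rw [hasFDerivAt_pi']
  intro i
  have hpr : ∀ j : Λ, HasFDerivAt (fun u : Λ → ℝ => u j)
      (ContinuousLinearMap.proj (R := ℝ) (φ := fun _ : Λ => ℝ) j) u := fun j => hasFDerivAt_apply j u
  have h1 := (HasFDerivAt.fun_sum (u := Finset.univ) fun j _ =>
    ((((hpr j).fun_sub (hpr i)).exp).const_mul (coupling W i j))).fun_add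
      (((hpr i).fun_neg.exp).const_mul (pinning W i))
  refine HasFDerivAt.congr_fderiv h1 ?_
  ext x
  simp only [add_apply, sum_apply, smul_apply, sub_apply, neg_apply,
    ContinuousLinearMap.proj_apply, smul_eq_mul, ContinuousLinearMap.comp_apply,
    LinearMap.coe_toContinuousLinearMap', Matrix.toLin'_apply]
  rw [Matrix.neg_mulVec, Pi.neg_apply, ← Matrix.mulVec_mulVec, ← Matrix.mulVec_mulVec,
    Matrix.mulVec_diagonal, schr, Matrix.sub_mulVec, Pi.sub_apply, Matrix.mulVec_diagonal,
    Matrix.mulVec_diagonal, potential]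
  simp only [Matrix.mulVec, dotProduct, Matrix.diagonal_apply]
  simp only [ite_mul, zero_mul, Finset.sum_ite_eq, Finset.mem_univ, if_true]
  have e1 : ∀ j, Real.exp (u j - u i) = Real.exp (u j) * Real.exp (- u i) := fun j => by
    rw [← Real.exp_add, sub_eq_add_neg]
  have e2 : Real.exp (-u i) * Real.exp (u i) = 1 := by rw [← Real.exp_add]; simp
  simp only [e1, mul_sub, Finset.sum_sub_distrib]
  have e3 : ∑ j, coupling W i j * (Real.exp (u j) * Real.exp (-u i) * x j) =
      Real.exp (- u i) * ∑ j, coupling W i j * (Real.exp (u j) * x j) := by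
    rw [Finset.mul_sum]
    exact Finset.sum_congr rfl fun j _ => by ring
  have e4 : ∑ j, coupling W i j * (Real.exp (u j) * Real.exp (-u i) * x i) =
      (∑ j, coupling W i j * (Real.exp (u j) * Real.exp (-u i))) * x i := by
    rw [Finset.sum_mul]
    exact Finset.sum_congr rfl fun j _ => by ring
  rw [e3, e4]
  linear_combination ((∑ j, coupling W i j * (Real.exp (u j) * Real.exp (-u i))) +
    pinning W i * Real.exp (-u i)) * x i * e2

theorem injective_potential {W : Edge Λ → ℝ} (hW : ∀ e, 0 ≤ W e)
    (hconn : (graphPlus W).Connected) (o : Orientation Λ) : Function.Injective (potential W) := by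
  intro u u' h
  have h1 := schr_inv_mulVec_pinning u (schr_posDef hW hconn o u)
  have h2 := schr_inv_mulVec_pinning u' (schr_posDef hW hconn o u')
  have h3 : schr W u = schr W u' := by rw [schr, schr, h]
  rw [h3, h2] at h1
  funext i
  exact (Real.exp_injective (congrFun h1 i)).symm

/-- The fields `u` parametrize exactly the potentials for which the operator is positive definite:
`e^u` is the solution of `H e^u = h`. -/
theorem range_potential {W : Edge Λ → ℝ} (hW : ∀ e, 0 < W e) (o : Orientation Λ) :
    potential W '' Set.univ = {γ : Λ → ℝ | (Matrix.diagonal γ - coupling W).PosDef} := by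
  ext γ
  constructor
  · rintro ⟨u, -, rfl⟩
    exact schr_posDef (fun e => (hW e).le) (connected_of_pos hW) o u
  · intro hγ
    have hγ' : (Matrix.diagonal γ - coupling W).PosDef := hγ
    set H := Matrix.diagonal γ - coupling W with hH
    set t := H⁻¹.mulVec (pinning W) with ht
    have hsolve : H.mulVec t = pinning W := by
      rw [ht, Matrix.mulVec_mulVec, Matrix.mul_nonsing_inv _ hγ'.det_pos.ne'.isUnit,
        Matrix.one_mulVec]
    have htpos : ∀ i, 0 < t i := by
      refine pos_of_mulVec_pos hγ' (fun i j hij => ?_) fun i => ?_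
      · rw [hH, Matrix.sub_apply, Matrix.diagonal_apply_ne _ hij, zero_sub, neg_nonpos]
        exact coupling_nonneg (fun e => (hW e).le) i j
      · rw [hsolve]; exact pinning_pos hW i
    refine ⟨fun i => Real.log (t i), Set.mem_univ _, ?_⟩
    ext i
    have h1 := congrFun hsolve i
    rw [hH, Matrix.sub_mulVec, Pi.sub_apply, Matrix.mulVec_diagonal] at h1
    simp only [Matrix.mulVec, dotProduct] at h1
    simp only [potential, Real.exp_sub, Real.exp_neg, Real.exp_log (htpos _)]
    rw [← h1]
    have := (htpos i).ne'
    rw [Finset.sum_congr rfl fun j _ => show coupling W i j * (t j / t i) =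
      coupling W i j * t j * (t i)⁻¹ by ring, ← Finset.sum_mul]
    field_simp
    ring

/-- Since `H⁻¹ h = e^u`, the exponent of `schrDensity` is the action of the `u`-field. -/
theorem schr_action_eq (W : Edge Λ → ℝ) (o : Orientation Λ) (u : Λ → ℝ)
    (hH : (schr W u).PosDef) :
    -(1 / 2) * (1 ⬝ᵥ (schr W u).mulVec 1) -
      1 / 2 * (pinning W ⬝ᵥ (schr W u)⁻¹.mulVec (pinning W)) + ∑ i, pinning W i =
    - ∑ e, W e * (Real.cosh (ext u (o.plus e) - ext u (o.minus e)) - 1) := by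
  rw [schr_inv_mulVec_pinning u hH]
  have h1 := sum_pairs_eq_sum_edges o
    (fun i j => 1 / 2 * weight W i j * (Real.exp (ext u j - ext u i) - 1)) (by intro i; simp)
  have h2 : ∑ e, W e * (Real.cosh (ext u (o.plus e) - ext u (o.minus e)) - 1) =
      ∑ i, ∑ j, 1 / 2 * weight W i j * (Real.exp (ext u j - ext u i) - 1) := by
    rw [h1]
    refine Finset.sum_congr rfl fun e _ => ?_
    simp only [weight_comm W (o.minus e)]
    rw [weight_eq, Real.cosh_eq, neg_sub]
    ring
  rw [h2]
  simp only [Fintype.sum_option, ext, Option.elim, weight_self]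
  have h3 : (1 : Λ → ℝ) ⬝ᵥ (schr W u).mulVec 1 =
      ∑ i, potential W u i - ∑ i, ∑ j, coupling W i j := by
    rw [schr, Matrix.sub_mulVec, dotProduct_sub]
    simp [dotProduct, Matrix.mulVec, Matrix.diagonal_apply]
  rw [h3]
  simp only [potential, dotProduct, weight_comm W none]
  change _ = -(_ + ∑ i, 1 / 2 * pinning W i * _ +
    ∑ i, (1 / 2 * pinning W i * _ + ∑ j, 1 / 2 * coupling W i j * _))
  simp only [Finset.sum_add_distrib, mul_sub, mul_one, Finset.sum_sub_distrib, sub_zero, zero_sub,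
    mul_assoc, ← Finset.mul_sum]
  ring

/-- The normalization of the marginal law of the `u`-field, by the substitution `γ = potential W u`,
whose Jacobian is `det H` up to sign. -/
theorem lintegral_sqrt_det_schr {W : Edge Λ → ℝ} (hW : ∀ e, 0 < W e) (o : Orientation Λ) :
    ∫⁻ u : Λ → ℝ, ENNReal.ofReal (√(schr W u).det *
      Real.exp (- ∑ e, W e * (Real.cosh (ext u (o.plus e) - ext u (o.minus e)) - 1))) =
    ENNReal.ofReal (√(2 * Real.pi) ^ Fintype.card Λ) := by
  have hpd := schr_posDef (fun e => (hW e).le) (connected_of_pos hW) o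
  rw [← lintegral_schrDensity (coupling_isHermitian W) (coupling_nonneg fun e => (hW e).le)
    (pinning_pos hW)]
  have h1 : ∫⁻ γ, schrDensity (coupling W) (pinning W) γ =
      ∫⁻ γ in potential W '' Set.univ, schrDensity (coupling W) (pinning W) γ := by
    rw [range_potential hW o, ← lintegral_indicator (measurableSet_posDef _)]
    refine lintegral_congr fun γ => ?_
    by_cases h : (Matrix.diagonal γ - coupling W).PosDef
    · rw [Set.indicator_of_mem]; exact h
    · rw [Set.indicator_of_notMem (by exact h), schrDensity, if_neg h]
  rw [h1, lintegral_image_eq_lintegral_abs_det_fderiv_mul volume MeasurableSet.univ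
    (fun u _ => (hasFDerivAt_potential W u).hasFDerivWithinAt)
    (injective_potential (fun e => (hW e).le) (connected_of_pos hW) o).injOn, setLIntegral_univ]
  refine lintegral_congr fun u => ?_
  have hdet := (hpd u).det_pos
  have h2 : |(LinearMap.toContinuousLinearMap (Matrix.toLin'
      (-(Matrix.diagonal (fun i => Real.exp (- u i)) * schr W u *
        Matrix.diagonal (fun i => Real.exp (u i)))))).det| = (schr W u).det := by
    rw [ContinuousLinearMap.det, LinearMap.coe_toContinuousLinearMap, LinearMap.det_toLin',
      Matrix.det_neg, Matrix.det_mul, Matrix.det_mul, Matrix.det_diagonal, Matrix.det_diagonal,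
      abs_mul, abs_pow, abs_neg, abs_one, one_pow, one_mul, mul_right_comm,
      ← Finset.prod_mul_distrib]
    simp only [← Real.exp_add, neg_add_cancel, Real.exp_zero, Finset.prod_const_one, one_mul]
    exact abs_of_pos hdet
  rw [h2, schrDensity, if_pos (show (Matrix.diagonal (potential W u) - coupling W).PosDef from hpd u)]
  change _ = _ * ENNReal.ofReal (Real.exp (-(1 / 2) *
    (1 ⬝ᵥ (schr W u).mulVec 1) - 1 / 2 * (pinning W ⬝ᵥ (schr W u)⁻¹.mulVec (pinning W)) +
    ∑ i, pinning W i) / √(schr W u).det)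
  rw [schr_action_eq W o u (hpd u), ← ENNReal.ofReal_mul hdet.le]
  congr 1
  nth_rewrite 2 [← Real.mul_self_sqrt hdet.le]
  have := (Real.sqrt_pos.2 hdet).ne'
  field_simp

theorem energy_eq (W : Edge Λ → ℝ) (o : Orientation Λ) (p : (Λ → ℝ) × (Λ → ℝ)) :
    energy W p = ∑ e, W e * Real.cosh (ext p.1 (o.plus e) - ext p.1 (o.minus e)) +
      1 / 2 * (p.2 ⬝ᵥ (D W p.1).mulVec p.2) := by
  rw [D_eq_lap o, dotProduct_lap_mulVec, Finset.mul_sum, ← Finset.sum_add_distrib]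
  refine Finset.sum_congr rfl fun e _ => ?_
  rw [edgeB_eq o, B, expW]
  ring

theorem continuous_energy (o : Orientation Λ) (W : Edge Λ → ℝ) : Continuous (energy W) :=
  continuous_finsetSum _ fun e _ => continuous_const.mul (continuous_edgeB o e)

theorem continuous_D (o : Orientation Λ) (W : Edge Λ → ℝ) : Continuous (D W) := by
  have : D W = fun u => lap o (fun e => W e * expW o u e) := funext fun u => D_eq_lap o W u
  rw [this]
  exact continuous_lap o fun e => continuous_const.mul (continuous_expW o e)

/-- The normalization of the `H^{2|2}` measure when all weights are positive; given `u`, the field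
`s` is Gaussian with covariance `D⁻¹`. -/
theorem lintegral_exp_neg_energy {W : Edge Λ → ℝ} (hW : ∀ e, 0 < W e) (o : Orientation Λ) :
    ∫⁻ p : (Λ → ℝ) × (Λ → ℝ), ENNReal.ofReal
      ((D W p.1).det * siteWeight p.1 * Real.exp (- energy W p)) =
    ENNReal.ofReal (Real.exp (- ∑ e, W e)) := by
  have hpd : ∀ u, (D W u).PosDef := fun u => by
    rw [D_eq_lap o]
    exact lap_posDef o (connected_of_pos hW) (fun e => mul_nonneg (hW e).le (expW_pos o u e).le)
      fun e he => mul_pos he (expW_pos o u e)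
  have hm : Measurable fun p : (Λ → ℝ) × (Λ → ℝ) => ENNReal.ofReal
      ((D W p.1).det * siteWeight p.1 * Real.exp (- energy W p)) := by
    refine ENNReal.measurable_ofReal.comp (Continuous.measurable ?_)
    exact ((((continuous_D o W).comp continuous_fst).matrix_det).mul
      (continuous_siteWeight.comp continuous_fst)).mul
      (Real.continuous_exp.comp (continuous_energy o W).neg)
  rw [Measure.volume_eq_prod, lintegral_prod _ hm.aemeasurable]
  have h1 : ∀ u : Λ → ℝ, ∫⁻ s : Λ → ℝ, ENNReal.ofReal
      ((D W u).det * siteWeight u * Real.exp (- energy W (u, s))) =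
      ENNReal.ofReal (Real.exp (- ∑ e, W e) / √(2 * Real.pi) ^ Fintype.card Λ) *
      ENNReal.ofReal (√(schr W u).det *
      Real.exp (- ∑ e, W e * (Real.cosh (ext u (o.plus e) - ext u (o.minus e)) - 1))) := by
    intro u
    have hsw := siteWeight_pos u
    have hd := (hpd u).det_pos
    have hH := (schr_posDef (fun e => (hW e).le) (connected_of_pos hW) o u).det_pos
    set K := (D W u).det * siteWeight u * Real.exp (- ∑ e, W e *
      Real.cosh (ext u (o.plus e) - ext u (o.minus e))) with hK
    have hK0 : 0 ≤ K := by positivity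
    have e1 : ∀ s : Λ → ℝ, ENNReal.ofReal
        ((D W u).det * siteWeight u * Real.exp (- energy W (u, s))) =
        ENNReal.ofReal K * ENNReal.ofReal (Real.exp (-(1 / 2) * (s ⬝ᵥ (D W u).mulVec s))) := by
      intro s
      rw [← ENNReal.ofReal_mul hK0, energy_eq W o, hK, mul_assoc _ (Real.exp _), ← Real.exp_add]
      congr 3
      ring
    simp only [e1]
    rw [lintegral_const_mul' _ _ (by simp), lintegral_exp_neg_quadratic (hpd u),
      ← ENNReal.ofReal_mul hK0, ← ENNReal.ofReal_mul (by positivity)]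
    congr 1
    have e2 : √(D W u).det = (∏ i, Real.exp (u i)) * √(schr W u).det := by
      rw [det_D_eq, Real.sqrt_mul (sq_nonneg _), Real.sqrt_sq]
      exact Finset.prod_nonneg fun i _ => (Real.exp_pos _).le
    have e3 : siteWeight u = (∏ i, Real.exp (u i))⁻¹ / (√(2 * Real.pi) ^ Fintype.card Λ) ^ 2 := by
      rw [← pow_mul, mul_comm _ 2, pow_mul, Real.sq_sqrt (by positivity), siteWeight,
        Finset.prod_div_distrib, Finset.prod_const, Finset.card_univ, ← Finset.prod_inv_distrib]
      simp only [Real.exp_neg]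
    have e4 : - ∑ e, W e * (Real.cosh (ext u (o.plus e) - ext u (o.minus e)) - 1) =
        ∑ e, W e + - ∑ e, W e * Real.cosh (ext u (o.plus e) - ext u (o.minus e)) := by
      simp only [mul_sub, mul_one, Finset.sum_sub_distrib]
      ring
    have hP : 0 < ∏ i, Real.exp (u i) := Finset.prod_pos fun i _ => Real.exp_pos _
    have hS : 0 < √(schr W u).det := Real.sqrt_pos.2 hH
    have hE : Real.exp (∑ e, W e) * Real.exp (- ∑ e, W e) = 1 := by rw [← Real.exp_add]; simp
    have e5 : (D W u).det = ((∏ i, Real.exp (u i)) * √(schr W u).det) ^ 2 := by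
      rw [← e2, Real.sq_sqrt hd.le]
    rw [hK, e2, e3, e4, e5, Real.exp_add, Real.exp_neg]
    field_simp
    rw [mul_comm, hE]
  simp only [h1]
  rw [lintegral_const_mul' _ _ (by simp), lintegral_sqrt_det_schr hW o,
    ← ENNReal.ofReal_mul (by positivity)]
  congr 1
  field_simp

end

/-! ### The localization identity -/

section
variable {Λ : Type*}

theorem graphPlus_mono [DecidableEq Λ] {W W' : Edge Λ → ℝ} (h : ∀ e, 0 < W e → 0 < W' e) :
    graphPlus W ≤ graphPlus W' := by
  intro i j hij
  have hne := hij.ne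
  have h1 : 0 < weight W i j := hij
  change 0 < weight W' i j
  rw [weight, dif_neg hne] at h1 ⊢
  exact h _ h1

/-- The Laplacian weights `-f_e' / f_e · e^{u_i + u_j}` at `B_e`, for `f_e (B) = B ^ {m_e} e^{- W_e B}`:
`(W_e - m_e / B_e) e^{u_i + u_j}`. -/
def tiltedWeight (o : Orientation Λ) (m W : Edge Λ → ℝ) (p : (Λ → ℝ) × (Λ → ℝ)) (e : Edge Λ) : ℝ :=
  (W e - m e / edgeB p.1 p.2 e) * expW o p.1 e

theorem continuous_edgeB_rpow (o : Orientation Λ) (e : Edge Λ) (m : ℝ) :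
    Continuous fun p : (Λ → ℝ) × (Λ → ℝ) => edgeB p.1 p.2 e ^ m :=
  (continuous_edgeB o e).rpow_const fun _ => Or.inl (edgeB_pos _ _ e).ne'

theorem continuous_tiltedWeight (o : Orientation Λ) (m W : Edge Λ → ℝ) (e : Edge Λ) :
    Continuous fun p => tiltedWeight o m W p e :=
  (continuous_const.sub (continuous_const.div (continuous_edgeB o e)
    fun _ => (edgeB_pos _ _ e).ne')).mul ((continuous_expW o e).comp continuous_fst)

section
variable [Fintype Λ]

theorem polyGrowth_tiltedWeight (o : Orientation Λ) (m W : Edge Λ → ℝ) (e : Edge Λ) :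
    PolyGrowth fun p => tiltedWeight o m W p e := by
  refine PolyGrowth.mul ((PolyGrowth.const _).sub ?_) (polyGrowth_expW o e)
  refine (PolyGrowth.const (m e)).mono fun p => ?_
  have h1 := one_le_edgeB p.1 p.2 e
  rw [abs_div, abs_of_pos (edgeB_pos p.1 p.2 e)]
  exact div_le_self (abs_nonneg _) h1

theorem polyGrowth_siteWeight :
    PolyGrowth fun p : (Λ → ℝ) × (Λ → ℝ) => siteWeight p.1 := by
  refine PolyGrowth.prod _ fun i => ?_
  simp only [div_eq_mul_inv]
  exact (polyGrowth_exp_neg i).mul (PolyGrowth.const _)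

end

theorem continuous_update [DecidableEq Λ] {c : (Λ → ℝ) × (Λ → ℝ) → Edge Λ → ℝ}
    (hc : ∀ e, Continuous fun p => c p e) (e0 : Edge Λ) {x : (Λ → ℝ) × (Λ → ℝ) → ℝ}
    (hx : Continuous x) (e : Edge Λ) : Continuous fun p => Function.update (c p) e0 (x p) e := by
  by_cases he : e = e0
  · subst he; simpa using hx
  · simpa [Function.update_of_ne he] using hc e

variable [Fintype Λ] [DecidableEq Λ]

/-- The Lebesgue density whose integral is computed by localization: it is the multilinear
expression in `f_e` and `- f_e'` with `f_e (B) = B ^ {m_e} e^{- W_e B}`. -/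
def locDensity (o : Orientation Λ) (m W : Edge Λ → ℝ) (p : (Λ → ℝ) × (Λ → ℝ)) : ℝ :=
  (∏ e, edgeB p.1 p.2 e ^ m e) * (lap o (tiltedWeight o m W p)).det * siteWeight p.1 *
    Real.exp (- energy W p)

theorem PolyGrowth.det_lap (o : Orientation Λ) {c : (Λ → ℝ) × (Λ → ℝ) → Edge Λ → ℝ}
    (hc : ∀ e, PolyGrowth fun p => c p e) : PolyGrowth fun p => (lap o (c p)).det := by
  refine PolyGrowth.det fun i j => ?_
  simp only [lap_apply]
  exact PolyGrowth.sum _ fun e => (hc e).mul (PolyGrowth.const _)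

theorem PolyGrowth.update {c : (Λ → ℝ) × (Λ → ℝ) → Edge Λ → ℝ}
    (hc : ∀ e, PolyGrowth fun p => c p e) (e0 : Edge Λ) {x : (Λ → ℝ) × (Λ → ℝ) → ℝ}
    (hx : PolyGrowth x) (e : Edge Λ) : PolyGrowth fun p => Function.update (c p) e0 (x p) e := by
  by_cases he : e = e0
  · subst he; simpa using hx
  · simpa [Function.update_of_ne he] using hc e

/-- The product of all scalar factors of `locDensity` except those of the edge `e₀`. -/
def restFactor (m W : Edge Λ → ℝ) (e0 : Edge Λ) (p : (Λ → ℝ) × (Λ → ℝ)) : ℝ :=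
  (∏ e ∈ Finset.univ.erase e0, edgeB p.1 p.2 e ^ m e) * siteWeight p.1 *
    Real.exp (- ∑ e ∈ Finset.univ.erase e0, W e * edgeB p.1 p.2 e)

/-- The coefficient of `f_{e₀}`. -/
def coeffVal (o : Orientation Λ) (m W : Edge Λ → ℝ) (e0 : Edge Λ) (p : (Λ → ℝ) × (Λ → ℝ)) : ℝ :=
  restFactor m W e0 p * (lap o (Function.update (tiltedWeight o m W p) e0 0)).det

/-- The coefficient of `- f_{e₀}'`. -/
def coeffDeriv (o : Orientation Λ) (m W : Edge Λ → ℝ) (e0 : Edge Λ) (p : (Λ → ℝ) × (Λ → ℝ)) : ℝ :=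
  restFactor m W e0 p * ((lap o (Function.update (tiltedWeight o m W p) e0 (expW o p.1 e0))).det -
    (lap o (Function.update (tiltedWeight o m W p) e0 0)).det)

theorem energy_update (W : Edge Λ → ℝ) (e0 : Edge Λ) (w : ℝ) (p : (Λ → ℝ) × (Λ → ℝ)) :
    energy (Function.update W e0 w) p = w * edgeB p.1 p.2 e0 +
      ∑ e ∈ Finset.univ.erase e0, W e * edgeB p.1 p.2 e := by
  rw [energy, ← Finset.add_sum_erase _ _ (Finset.mem_univ e0), Function.update_self]
  congr 1
  exact Finset.sum_congr rfl fun e he => by rw [Function.update_of_ne (Finset.ne_of_mem_erase he)]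

/-- As a function of `f (B) = B ^ k e^{- w B}` at the edge `e₀`, the density is
`coeffVal · f - coeffDeriv · f'`. -/
theorem locDensity_update (o : Orientation Λ) (m W : Edge Λ → ℝ) (e0 : Edge Λ) (k w : ℝ)
    (p : (Λ → ℝ) × (Λ → ℝ)) :
    locDensity o (Function.update m e0 k) (Function.update W e0 w) p =
      (coeffVal o m W e0 p + coeffDeriv o m W e0 p * (w - k / edgeB p.1 p.2 e0)) *
        (edgeB p.1 p.2 e0 ^ k * Real.exp (-(w * edgeB p.1 p.2 e0))) := by
  have h1 : tiltedWeight o (Function.update m e0 k) (Function.update W e0 w) p =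
      Function.update (tiltedWeight o m W p) e0
        ((w - k / edgeB p.1 p.2 e0) * expW o p.1 e0) := by
    funext e
    by_cases he : e = e0
    · subst he; simp [tiltedWeight]
    · simp [tiltedWeight, Function.update_of_ne he]
  have h2 : ∏ e, edgeB p.1 p.2 e ^ (Function.update m e0 k e) = edgeB p.1 p.2 e0 ^ k *
      ∏ e ∈ Finset.univ.erase e0, edgeB p.1 p.2 e ^ m e := by
    rw [← Finset.mul_prod_erase _ _ (Finset.mem_univ e0), Function.update_self]
    congr 1
    exact Finset.prod_congr rfl fun e he => by
      rw [Function.update_of_ne (Finset.ne_of_mem_erase he)]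
  rw [locDensity, h1, h2, det_lap_update, energy_update, neg_add, Real.exp_add, coeffVal,
    coeffDeriv, restFactor]
  ring

theorem integrable_locDensity {W : Edge Λ → ℝ} (hW : ∀ e, 0 ≤ W e)
    (hconn : (graphPlus W).Connected) (o : Orientation Λ) (m : Edge Λ → ℝ) :
    Integrable (locDensity o m W) := by
  refine PolyGrowth.integrable hW hconn (((PolyGrowth.prod _ fun e =>
    polyGrowth_edgeB_rpow e (m e)).mul (PolyGrowth.det_lap o (polyGrowth_tiltedWeight o m W))).mul
    polyGrowth_siteWeight) (Continuous.aestronglyMeasurable ?_)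
  exact ((((continuous_finsetProd _ fun e _ => continuous_edgeB_rpow o e (m e)).mul
    (continuous_lap o (continuous_tiltedWeight o m W)).matrix_det).mul
    (continuous_siteWeight.comp continuous_fst))).mul
    (Real.continuous_exp.comp (continuous_energy o W).neg)

theorem continuous_restFactor (o : Orientation Λ) (m W : Edge Λ → ℝ) (e0 : Edge Λ) :
    Continuous (restFactor m W e0) :=
  ((continuous_finsetProd _ fun e _ => continuous_edgeB_rpow o e (m e)).mul
    (continuous_siteWeight.comp continuous_fst)).mul
    (Real.continuous_exp.comp
      (continuous_finsetSum _ fun e _ => continuous_const.mul (continuous_edgeB o e)).neg)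

/-- Any polynomially bounded multiple of the rest factor is integrable against `e^{-W B}` at the
edge `e₀`, after multiplication by any power of `B`. -/
theorem integrable_restFactor_mul {W : Edge Λ → ℝ} (hW : ∀ e, 0 ≤ W e)
    (hconn : (graphPlus W).Connected) (o : Orientation Λ) (m : Edge Λ → ℝ) (e0 : Edge Λ)
    {f : (Λ → ℝ) × (Λ → ℝ) → ℝ} (hf : PolyGrowth f) (hfc : Continuous f) (N : ℕ) :
    Integrable (fun p => restFactor m W e0 p * f p * edgeB p.1 p.2 e0 ^ N *
      Real.exp (-(W e0 * edgeB p.1 p.2 e0))) := by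
  have h1 : (fun p : (Λ → ℝ) × (Λ → ℝ) => restFactor m W e0 p * f p * edgeB p.1 p.2 e0 ^ N *
      Real.exp (-(W e0 * edgeB p.1 p.2 e0))) = fun p =>
      ((∏ e ∈ Finset.univ.erase e0, edgeB p.1 p.2 e ^ m e) * siteWeight p.1 * f p *
        edgeB p.1 p.2 e0 ^ N) * Real.exp (- energy W p) := by
    funext p
    have := energy_update W e0 (W e0) p
    rw [Function.update_eq_self] at this
    rw [this, neg_add, Real.exp_add, restFactor]
    ring
  have h2 : Continuous (fun p : (Λ → ℝ) × (Λ → ℝ) => restFactor m W e0 p * f p *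
      edgeB p.1 p.2 e0 ^ N * Real.exp (-(W e0 * edgeB p.1 p.2 e0))) :=
    (((continuous_restFactor o m W e0).mul hfc).mul ((continuous_edgeB o e0).pow N)).mul
      (Real.continuous_exp.comp (continuous_const.mul (continuous_edgeB o e0)).neg)
  have h3 := h2.aestronglyMeasurable (μ := volume)
  rw [h1] at h3 ⊢
  exact PolyGrowth.integrable hW hconn ((((PolyGrowth.prod _ fun e =>
    polyGrowth_edgeB_rpow e (m e)).mul polyGrowth_siteWeight).mul hf).mul
    ((polyGrowth_edgeB e0).pow N)) h3

/-- Localization: only the values `f_e (1) = e^{-W_e}` enter the integral. The edges are converted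
one by one from pure exponentials, for which the identity is the normalization of the `H^{2|2}`
measure. -/
theorem integral_locDensity {W : Edge Λ → ℝ} (hW : ∀ e, 0 ≤ W e)
    (hconn : (graphPlus W).Connected) (o : Orientation Λ) (m : Edge Λ → ℝ) :
    ∫ p, locDensity o m W p = Real.exp (- ∑ e, W e) := by
  have key : ∀ S : Finset (Edge Λ), ∀ m W : Edge Λ → ℝ, (∀ e, 0 ≤ W e) →
      (graphPlus W).Connected → (∀ e ∉ S, m e = 0 ∧ 0 < W e) →
      ∫ p, locDensity o m W p = Real.exp (- ∑ e, W e) := by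
    intro S
    induction S using Finset.induction_on with
    | empty =>
      intro m W hW hconn hS
      have hm : m = 0 := funext fun e => (hS e (Finset.notMem_empty e)).1
      have hWp : ∀ e, 0 < W e := fun e => (hS e (Finset.notMem_empty e)).2
      have h1 : ∀ p, locDensity o m W p =
          (D W p.1).det * siteWeight p.1 * Real.exp (- energy W p) := by
        intro p
        rw [locDensity, D_eq_lap o]
        subst hm
        simp only [Pi.zero_apply, Real.rpow_zero, Finset.prod_const_one, one_mul]
        congr 4
        funext e
        simp [tiltedWeight]
      have h2 : ∀ p, 0 ≤ locDensity o m W p := by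
        intro p
        rw [h1, D_eq_lap o]
        have := (lap_posSemidef o fun e => mul_nonneg (hW e) (expW_pos o p.1 e).le).det_nonneg
        have := siteWeight_pos p.1
        positivity
      rw [integral_eq_lintegral_of_nonneg_ae (Filter.Eventually.of_forall h2)
        (integrable_locDensity hW hconn o m).aestronglyMeasurable]
      simp only [h1]
      rw [lintegral_exp_neg_energy hWp o, ENNReal.toReal_ofReal (Real.exp_pos _).le]
    | insert e0 S _ ih =>
      intro m W hW hconn hS
      have hdet1 : ∀ e, Continuous fun p =>
          Function.update (tiltedWeight o m W p) e0 0 e :=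
        continuous_update (continuous_tiltedWeight o m W) e0 continuous_const
      have hdet2 : ∀ e, Continuous fun p =>
          Function.update (tiltedWeight o m W p) e0 (expW o p.1 e0) e :=
        continuous_update (continuous_tiltedWeight o m W) e0
          ((continuous_expW o e0).comp continuous_fst)
      have hc1 := (continuous_lap o hdet1).matrix_det
      have hc2 := ((continuous_lap o hdet2).matrix_det).sub hc1
      have hg1 := PolyGrowth.det_lap o
        (PolyGrowth.update (polyGrowth_tiltedWeight o m W) e0 (PolyGrowth.const 0))
      have hg2 := (PolyGrowth.det_lap o
        (PolyGrowth.update (polyGrowth_tiltedWeight o m W) e0 (polyGrowth_expW o e0))).sub hg1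
      have hR := continuous_restFactor o m W e0
      have main := integral_rpow_mul_exp_of_exp (μ := volume)
        (b := fun p : (Λ → ℝ) × (Λ → ℝ) => edgeB p.1 p.2 e0) (X := coeffVal o m W e0)
        (Y := coeffDeriv o m W e0) (W := W e0)
        (C := Real.exp (- ∑ e ∈ Finset.univ.erase e0, W e))
        (fun p => one_le_edgeB _ _ _) (continuous_edgeB o e0).measurable
        (hR.mul hc1).measurable (hR.mul hc2).measurable (hW e0)
        (integrable_restFactor_mul hW hconn o m e0 hg1 hc1)
        (integrable_restFactor_mul hW hconn o m e0 hg2 hc2) ?_ (m e0)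
      · -- The parameters `m` and `W` themselves, viewed as updates at `e₀`.
        have h1 := locDensity_update o m W e0 (m e0) (W e0)
        rw [Function.update_eq_self, Function.update_eq_self] at h1
        simp only [h1]
        rw [main, ← Real.exp_add, ← Finset.add_sum_erase _ _ (Finset.mem_univ e0)]
        congr 1
        ring
      · -- For the pure exponential of weight `w > W e₀` at `e₀`, the induction hypothesis applies.
        intro w hw
        have hw0 : 0 < w := (hW e0).trans_lt hw
        have hsum : ∑ e, Function.update W e0 w e = w + ∑ e ∈ Finset.univ.erase e0, W e := by
          rw [← Finset.add_sum_erase _ _ (Finset.mem_univ e0), Function.update_self]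
          congr 1
          exact Finset.sum_congr rfl fun e he => by
            rw [Function.update_of_ne (Finset.ne_of_mem_erase he)]
        have h1 := ih (Function.update m e0 0) (Function.update W e0 w) ?_ ?_ ?_
        · simp only [locDensity_update, zero_div, sub_zero, Real.rpow_zero, one_mul] at h1
          rw [h1, hsum, ← Real.exp_add]
          congr 1
          ring
        · intro e
          by_cases he : e = e0
          · subst he; simpa using hw0.le
          · simpa [Function.update_of_ne he] using hW e
        · refine hconn.mono (graphPlus_mono fun e he' => ?_)
          by_cases he : e = e0
          · subst he; simpa using hw0
          · simpa [Function.update_of_ne he] using he'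
        · intro e heS
          by_cases he : e = e0
          · subst he; simpa using hw0
          · simpa [Function.update_of_ne he] using hS e (by simp [he, heS])
  exact key Finset.univ m W hW hconn fun e he => absurd (Finset.mem_univ e) he

/-! ### Expectations in the `H^{2|2}` model -/

theorem sum_edgesPlus {W : Edge Λ → ℝ} (hW : ∀ e, 0 ≤ W e) (f : Edge Λ → ℝ) :
    ∑ e ∈ edgesPlus W, W e * f e = ∑ e, W e * f e := by
  refine Finset.sum_subset (Finset.subset_univ _) fun e _ he => ?_
  have : W e = 0 := by
    simp only [edgesPlus, Finset.mem_filter, Finset.mem_univ, true_and, not_lt] at he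
    exact le_antisymm he (hW e)
  rw [this, zero_mul]

theorem density_eq {W : Edge Λ → ℝ} (hW : ∀ e, 0 ≤ W e) (p : (Λ → ℝ) × (Λ → ℝ)) :
    density W p.1 p.2 = Real.exp (∑ e, W e) *
      ((D W p.1).det * siteWeight p.1 * Real.exp (- energy W p)) := by
  rw [density, sum_edgesPlus hW (fun e => edgeB p.1 p.2 e - 1)]
  have : - ∑ e, W e * (edgeB p.1 p.2 e - 1) = ∑ e, W e + - energy W p := by
    simp only [mul_sub, mul_one, Finset.sum_sub_distrib, energy]
    ring
  rw [this, Real.exp_add, siteWeight]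
  ring

theorem density_nonneg {W : Edge Λ → ℝ} (hW : ∀ e, 0 ≤ W e) (o : Orientation Λ)
    (p : (Λ → ℝ) × (Λ → ℝ)) : 0 ≤ density W p.1 p.2 := by
  rw [density_eq hW, D_eq_lap o]
  have := (lap_posSemidef o fun e => mul_nonneg (hW e) (expW_pos o p.1 e).le).det_nonneg
  have := siteWeight_pos p.1
  positivity

theorem continuous_density {W : Edge Λ → ℝ} (hW : ∀ e, 0 ≤ W e) (o : Orientation Λ) :
    Continuous fun p : (Λ → ℝ) × (Λ → ℝ) => density W p.1 p.2 := by
  simp only [density_eq hW]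
  exact continuous_const.mul (((((continuous_D o W).comp continuous_fst).matrix_det).mul
      (continuous_siteWeight.comp continuous_fst)).mul
      (Real.continuous_exp.comp (continuous_energy o W).neg))

theorem measurable_ofReal_density {W : Edge Λ → ℝ} (hW : ∀ e, 0 ≤ W e) (o : Orientation Λ) :
    Measurable fun p : (Λ → ℝ) × (Λ → ℝ) => ENNReal.ofReal (density W p.1 p.2) :=
  ENNReal.measurable_ofReal.comp (continuous_density hW o).measurable

theorem integrable_mu_iff {W : Edge Λ → ℝ} (hW : ∀ e, 0 ≤ W e) (o : Orientation Λ)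
    (f : (Λ → ℝ) × (Λ → ℝ) → ℝ) :
    Integrable f (mu W) ↔ Integrable fun p => density W p.1 p.2 * f p := by
  rw [mu, integrable_withDensity_iff_integrable_smul'
    (measurable_ofReal_density hW o)
    (Filter.Eventually.of_forall fun p => ENNReal.ofReal_lt_top)]
  simp only [ENNReal.toReal_ofReal (density_nonneg hW o _), smul_eq_mul]

theorem integral_mu {W : Edge Λ → ℝ} (hW : ∀ e, 0 ≤ W e) (o : Orientation Λ)
    (f : (Λ → ℝ) × (Λ → ℝ) → ℝ) :
    ∫ p, f p ∂(mu W) = ∫ p : (Λ → ℝ) × (Λ → ℝ), density W p.1 p.2 * f p := by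
  rw [mu, integral_withDensity_eq_integral_toReal_smul
    (measurable_ofReal_density hW o)
    (Filter.Eventually.of_forall fun p => ENNReal.ofReal_lt_top)]
  simp only [ENNReal.toReal_ofReal (density_nonneg hW o _), smul_eq_mul]

/-- By the Weinstein–Aronszajn identity, `det D · det (1 - M 𝒢)` is the determinant of the Laplacian
with weights `(W_e - m_e / B_e) e^{u_i + u_j}`. -/
theorem det_D_mul_det {W : Edge Λ → ℝ} (hW : ∀ e, 0 ≤ W e) (hconn : (graphPlus W).Connected)
    (o : Orientation Λ) (m : Edge Λ → ℝ) (p : (Λ → ℝ) × (Λ → ℝ)) :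
    (D W p.1).det * (1 - Matrix.diagonal m * calG W o p.1 p.2).det =
      (lap o (tiltedWeight o m W p)).det := by
  have hpd : (D W p.1).PosDef := by
    rw [D_eq_lap o]
    exact lap_posDef o hconn (fun e => mul_nonneg (hW e) (expW_pos o p.1 e).le)
      fun e he => mul_pos he (expW_pos o p.1 e)
  have hu : IsUnit (D W p.1).det := hpd.det_pos.ne'.isUnit
  set S := Matrix.diagonal (fun e => √(Q o p.1 p.2 e)) with hS
  have h1 : Matrix.diagonal m * calG W o p.1 p.2 =
      (Matrix.diagonal m * S * (F o).transpose) * ((D W p.1)⁻¹ * F o * S) := by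
    simp only [calG, ← hS, Matrix.mul_assoc]
  have hSS : S * Matrix.diagonal m * S = Matrix.diagonal fun e => m e / edgeB p.1 p.2 e *
      expW o p.1 e := by
    rw [hS, Matrix.diagonal_mul_diagonal, Matrix.diagonal_mul_diagonal]
    congr 1
    funext e
    have hQ : 0 ≤ Q o p.1 p.2 e := div_nonneg (Real.exp_pos _).le (edgeB_pos _ _ e).le
    rw [mul_right_comm, Real.mul_self_sqrt hQ, Q, expW]
    ring
  have h2 : (D W p.1)⁻¹ * F o * S * (Matrix.diagonal m * S * (F o).transpose) =
      (D W p.1)⁻¹ * lap o fun e => m e / edgeB p.1 p.2 e * expW o p.1 e := by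
    rw [lap, ← hSS]
    simp only [Matrix.mul_assoc]
  rw [h1, Matrix.det_one_sub_mul_comm, h2, ← Matrix.det_mul, Matrix.mul_sub, Matrix.mul_one,
    ← Matrix.mul_assoc, Matrix.mul_nonsing_inv _ hu, Matrix.one_mul, D_eq_lap o]
  congr 1
  ext i j
  rw [Matrix.sub_apply, lap_apply, lap_apply, lap_apply, ← Finset.sum_sub_distrib]
  refine Finset.sum_congr rfl fun e _ => ?_
  rw [tiltedWeight]
  ring

theorem density_mul_eq_locDensity {W : Edge Λ → ℝ} (hW : ∀ e, 0 ≤ W e)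
    (hconn : (graphPlus W).Connected) (o : Orientation Λ) (m : Edge Λ → ℝ)
    (p : (Λ → ℝ) × (Λ → ℝ)) :
    density W p.1 p.2 * ((∏ e, edgeB p.1 p.2 e ^ m e) *
      (1 - Matrix.diagonal m * calG W o p.1 p.2).det) =
    Real.exp (∑ e, W e) * locDensity o m W p := by
  rw [density_eq hW, locDensity, ← det_D_mul_det hW hconn]
  ring

/-- The identity for the `H^{2|2}` expectation; it holds for real exponents of any sign. -/
theorem integrable_and_integral_prod_mul_det {W : Edge Λ → ℝ} (hW : ∀ e, 0 ≤ W e)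
    (hconn : (graphPlus W).Connected) (o : Orientation Λ) (m : Edge Λ → ℝ) :
    Integrable (fun p : (Λ → ℝ) × (Λ → ℝ) => (∏ e, edgeB p.1 p.2 e ^ m e) *
        (1 - Matrix.diagonal m * calG W o p.1 p.2).det) (mu W) ∧
      ∫ p : (Λ → ℝ) × (Λ → ℝ), (∏ e, edgeB p.1 p.2 e ^ m e) *
        (1 - Matrix.diagonal m * calG W o p.1 p.2).det ∂(mu W) = 1 := by
  rw [integrable_mu_iff hW o, integral_mu hW o]
  simp only [density_mul_eq_locDensity hW hconn]
  refine ⟨(integrable_locDensity hW hconn o m).const_mul _, ?_⟩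
  rw [integral_const_mul, integral_locDensity hW hconn, ← Real.exp_add, add_neg_cancel,
    Real.exp_zero]

theorem integrable_prod_edgeB {W : Edge Λ → ℝ} (hW : ∀ e, 0 ≤ W e)
    (hconn : (graphPlus W).Connected) (o : Orientation Λ) (m : Edge Λ → ℝ)
    (S : Finset (Edge Λ)) :
    Integrable (fun p : (Λ → ℝ) × (Λ → ℝ) => ∏ e ∈ S, edgeB p.1 p.2 e ^ m e) (mu W) := by
  have h1 : (fun p : (Λ → ℝ) × (Λ → ℝ) =>
      density W p.1 p.2 * ∏ e ∈ S, edgeB p.1 p.2 e ^ m e) = fun p =>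
      (Real.exp (∑ e, W e) * ((lap o (tiltedWeight o 0 W p)).det * siteWeight p.1) *
        ∏ e ∈ S, edgeB p.1 p.2 e ^ m e) * Real.exp (- energy W p) := by
    funext p
    have : tiltedWeight o 0 W p = fun e => W e * expW o p.1 e := by
      funext e; simp [tiltedWeight]
    rw [density_eq hW, this, D_eq_lap o]
    ring
  have h2 : Continuous (fun p : (Λ → ℝ) × (Λ → ℝ) =>
      density W p.1 p.2 * ∏ e ∈ S, edgeB p.1 p.2 e ^ m e) :=
    (continuous_density hW o).mul
      (continuous_finsetProd _ fun e _ => continuous_edgeB_rpow o e (m e))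
  have h3 := h2.aestronglyMeasurable (μ := volume)
  rw [integrable_mu_iff hW o]
  rw [h1] at h3 ⊢
  exact PolyGrowth.integrable hW hconn (((PolyGrowth.const _).mul
    ((PolyGrowth.det_lap o (polyGrowth_tiltedWeight o 0 W)).mul polyGrowth_siteWeight)).mul
    (PolyGrowth.prod _ fun e => polyGrowth_edgeB_rpow e (m e))) h3

/-- The pointwise lower bound `det (1 - M 𝒢) ≥ ∏ (1 - m_e / W_e)`, which holds because each weight
`W_e - m_e / B_e` is at least `(1 - m_e / W_e) W_e`. -/
theorem prod_le_det_one_sub {W : Edge Λ → ℝ} (hW : ∀ e, 0 ≤ W e)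
    (hconn : (graphPlus W).Connected) (o : Orientation Λ) {m : Edge Λ → ℝ} (hm : ∀ e, 0 ≤ m e)
    (hmW : ∀ e ∈ edgesPlus W, m e < W e) (hm0 : ∀ e ∉ edgesPlus W, m e = 0)
    (p : (Λ → ℝ) × (Λ → ℝ)) :
    ∏ e, (1 - m e / W e) ≤ (1 - Matrix.diagonal m * calG W o p.1 p.2).det := by
  have hpd : (D W p.1).PosDef := by
    rw [D_eq_lap o]
    exact lap_posDef o hconn (fun e => mul_nonneg (hW e) (expW_pos o p.1 e).le)
      fun e he => mul_pos he (expW_pos o p.1 e)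
  have hle : ∀ e, m e / W e ≤ 1 := by
    intro e
    by_cases he : e ∈ edgesPlus W
    · exact div_le_one_of_le₀ (hmW e he).le (hW e)
    · rw [hm0 e he, zero_div]; exact zero_le_one
  have hq : ∀ e, 0 ≤ m e / W e := fun e => div_nonneg (hm e) (hW e)
  have hqB : ∀ e, m e / W e / edgeB p.1 p.2 e ≤ m e / W e := fun e =>
    div_le_self (hq e) (one_le_edgeB _ _ e)
  set t : Edge Λ → ℝ := fun e => 1 - m e / W e / edgeB p.1 p.2 e with ht
  have h1 := prod_mul_det_lap_le o (c := fun e => W e * expW o p.1 e) (t := t)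
    (fun e => mul_nonneg (hW e) (expW_pos o p.1 e).le)
    (fun e => sub_nonneg.2 ((hqB e).trans (hle e)))
    (fun e => sub_le_self _ (div_nonneg (hq e) (edgeB_pos _ _ e).le))
  have h2 : (fun e => t e * (W e * expW o p.1 e)) = tiltedWeight o m W p := by
    funext e
    rw [ht, tiltedWeight]
    by_cases he : W e = 0
    · have : e ∉ edgesPlus W := by simp [edgesPlus, he]
      rw [hm0 e this, he]
      simp
    · have := (edgeB_pos p.1 p.2 e).ne'
      field_simp
  rw [h2, ← D_eq_lap o, ← det_D_mul_det hW hconn, mul_comm] at h1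
  refine le_trans ?_ (le_of_mul_le_mul_left h1 hpd.det_pos)
  exact Finset.prod_le_prod (fun e _ => sub_nonneg.2 (hle e))
    fun e _ => sub_le_sub_left (hqB e) 1

theorem prod_edgesPlus_edgeB {W m : Edge Λ → ℝ} (hm0 : ∀ e ∉ edgesPlus W, m e = 0)
    (u s : Λ → ℝ) : ∏ e ∈ edgesPlus W, edgeB u s e ^ m e = ∏ e, edgeB u s e ^ m e :=
  Finset.prod_subset (Finset.subset_univ _) fun e _ he => by rw [hm0 e he, Real.rpow_zero]

theorem integrable_prod_cosh {W : Edge Λ → ℝ} (hW : ∀ e, 0 ≤ W e)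
    (hconn : (graphPlus W).Connected) (o : Orientation Λ) {m : Edge Λ → ℝ} (hm : ∀ e, 0 ≤ m e)
    (S : Finset (Edge Λ)) :
    Integrable (fun p : (Λ → ℝ) × (Λ → ℝ) =>
      ∏ e ∈ S, Real.cosh (ext p.1 (o.plus e) - ext p.1 (o.minus e)) ^ m e) (mu W) := by
  refine (integrable_prod_edgeB hW hconn o m S).mono' (Continuous.aestronglyMeasurable ?_)
    (Filter.Eventually.of_forall fun p => ?_)
  · refine continuous_finsetProd _ fun e _ => Continuous.rpow_const ?_ fun p =>
      Or.inl (Real.cosh_pos _).ne'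
    exact Real.continuous_cosh.comp (((continuous_ext _).comp continuous_fst).sub
      ((continuous_ext _).comp continuous_fst))
  · rw [Real.norm_of_nonneg (Finset.prod_nonneg fun _ _ => Real.rpow_nonneg (Real.cosh_pos _).le _)]
    exact prod_cosh_le_prod_edgeB o hm S p.1 p.2

theorem integral_prod_edgeB_le {W : Edge Λ → ℝ} (hW : ∀ e, 0 ≤ W e)
    (hconn : (graphPlus W).Connected) (o : Orientation Λ) {m : Edge Λ → ℝ} (hm : ∀ e, 0 ≤ m e)
    (hmW : ∀ e ∈ edgesPlus W, m e < W e) (hm0 : ∀ e ∉ edgesPlus W, m e = 0) :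
    ∫ p : (Λ → ℝ) × (Λ → ℝ), ∏ e ∈ edgesPlus W, edgeB p.1 p.2 e ^ m e ∂(mu W) ≤
      ∏ e ∈ edgesPlus W, 1 / (1 - m e / W e) := by
  obtain ⟨h1, h2⟩ := integrable_and_integral_prod_mul_det hW hconn o m
  have hi := integrable_prod_edgeB hW hconn o m (edgesPlus W)
  have hp : ∏ e, (1 - m e / W e) = ∏ e ∈ edgesPlus W, (1 - m e / W e) :=
    (Finset.prod_subset (Finset.subset_univ _) fun e _ he => by simp [hm0 e he]).symm
  have hpos : 0 < ∏ e ∈ edgesPlus W, (1 - m e / W e) := by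
    refine Finset.prod_pos fun e he => ?_
    have hWe : 0 < W e := (hm e).trans_lt (hmW e he)
    rw [sub_pos, div_lt_one hWe]
    exact hmW e he
  have h3 := integral_mono (hi.mul_const (∏ e, (1 - m e / W e))) h1 fun p => by
    simp only [prod_edgesPlus_edgeB hm0]
    exact mul_le_mul_of_nonneg_left (prod_le_det_one_sub hW hconn o hm hmW hm0 p)
      (Finset.prod_nonneg fun e _ => Real.rpow_nonneg (edgeB_pos _ _ e).le _)
  rw [h2, integral_mul_const, hp] at h3
  rw [Finset.prod_div_distrib, Finset.prod_const_one, le_div_iff₀ hpos]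
  exact h3

end

end H22

end

theorem mainTheorem7 {Λ : Type*} [Fintype Λ] [DecidableEq Λ]
    (W : H22.Edge Λ → ℝ) (hW : ∀ e, 0 ≤ W e) (hconn : (H22.graphPlus W).Connected)
    (o : H22.Orientation Λ) (m : H22.Edge Λ → ℝ) (hm : ∀ e, 0 ≤ m e) :
    (Integrable (fun p : (Λ → ℝ) × (Λ → ℝ) =>
        (∏ e, H22.edgeB p.1 p.2 e ^ m e) *
          (1 - Matrix.diagonal m * H22.calG W o p.1 p.2).det) (H22.mu W) ∧
      ∫ p : (Λ → ℝ) × (Λ → ℝ),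
        (∏ e, H22.edgeB p.1 p.2 e ^ m e) *
          (1 - Matrix.diagonal m * H22.calG W o p.1 p.2).det ∂(H22.mu W) = 1) ∧
    ((∀ e ∈ H22.edgesPlus W, m e < W e) → (∀ e ∉ H22.edgesPlus W, m e = 0) →
      Integrable (fun p : (Λ → ℝ) × (Λ → ℝ) =>
        ∏ e ∈ H22.edgesPlus W,
          Real.cosh (H22.ext p.1 (o.plus e) - H22.ext p.1 (o.minus e)) ^ m e) (H22.mu W) ∧
      Integrable (fun p : (Λ → ℝ) × (Λ → ℝ) =>
        ∏ e ∈ H22.edgesPlus W, H22.edgeB p.1 p.2 e ^ m e) (H22.mu W) ∧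
      ∫ p : (Λ → ℝ) × (Λ → ℝ),
        ∏ e ∈ H22.edgesPlus W,
          Real.cosh (H22.ext p.1 (o.plus e) - H22.ext p.1 (o.minus e)) ^ m e ∂(H22.mu W)
        ≤ ∫ p : (Λ → ℝ) × (Λ → ℝ),
          ∏ e ∈ H22.edgesPlus W, H22.edgeB p.1 p.2 e ^ m e ∂(H22.mu W) ∧
      ∫ p : (Λ → ℝ) × (Λ → ℝ),
        ∏ e ∈ H22.edgesPlus W, H22.edgeB p.1 p.2 e ^ m e ∂(H22.mu W)
        ≤ ∏ e ∈ H22.edgesPlus W, 1 / (1 - m e / W e)) := by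
  refine ⟨H22.integrable_and_integral_prod_mul_det hW hconn o m, fun hmW hm0 => ?_⟩
  have hc := H22.integrable_prod_cosh hW hconn o hm (H22.edgesPlus W)
  have hB := H22.integrable_prod_edgeB hW hconn o m (H22.edgesPlus W)
  exact ⟨hc, hB, integral_mono hc hB fun p => H22.prod_cosh_le_prod_edgeB o hm _ p.1 p.2,
    H22.integral_prod_edgeB_le hW hconn o hm hmW hm0⟩
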